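/- Let $\Sigma$ be a compact smooth 3-manifold without boundary and $\Lambda\in\mathbb R$. For a Riemannian metric $g_{ab}$, a symmetric contravariant 2-tensor density $\pi^{ab}$ of weight one and a function $\phi$ on $\Sigma$, put $\pi=\pi^{ab}g_{ab}$, $\langle\pi\rangle=\int_\Sigma \pi\,d^3x\big/\int_\Sigma\sqrt g\,d^3x$, $$\frac{S}{\sqrt g}(g,\pi)=\frac1g\Big(\pi^{ab}\pi_{ab}-\tfrac12\pi^2\Big)-R[g]+2\Lambda ,$$ $$T_\phi g_{ab}=e^{4\phi}g_{ab},\qquad T_\phi\pi^{ab}=e^{-4\phi}\Big(\pi^{ab}-\tfrac13\langle\pi\rangle\,(1-e^{6\phi})\,g^{ab}\sqrt g\Big),$$ and let $T_\phi\frac{S}{\sqrt g}$ be the value of $S/\sqrt g$ at $(T_\phi g,T_\phi\pi)$. Let $(g_\epsilon,\pi_\epsilon,\phi_\epsilon)$, $|\epsilon|<\delta$, be a family of such data that is jointly smooth in $\epsilon$ and the point of $\Sigma$, with background $(g_0,\pi_0)$ and perturbations $h_{(k)},p_{(k)}$ defined as the coefficients of $\epsilon^k$ in $g_\epsilon,\pi_\epsilon$,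 $k\ge1$ (for example $g_\epsilon=g_0+\epsilon h$, $\pi_\epsilon=\pi_0+\epsilon p$). Let $\omega_{(k)}$ be the coefficient of $\epsilon^k$ in $\Omega^6$, where $\Omega=e^{\phi_\epsilon}$, and write $h_{(0)}=g_0$, $p_{(0)}=\pi_0$. (Here the coefficient of $\epsilon^k$ means $\frac1{k!}\frac{d^k}{d\epsilon^k}\big|_{\epsilon=0}$.) Then $\epsilon\mapsto T_{\phi_\epsilon}\frac{S}{\sqrt g}(g_\epsilon,\pi_\epsilon)(x)$ is smooth at $\epsilon=0$ for every $x\in\Sigma$, and for every $n>0$ its coefficient of $\epsilon^n$ equals $$\tfrac43\big(\nabla^2+m_{(n)}^2\big)\frac{\omega_{(n)}}{\omega_{(0)}}-f_{(n)} .$$ In particular, if $T_{\phi_\epsilon}\frac{S}{\sqrt g}(g_\epsilon,\pi_\epsilon)=\mathcal H_{\rm dual}(\epsilon)$ on $\Sigma$ for all small $\epsilon$, with $\mathcal H_{\rm dual}(\epsilon)$ constant on $\Sigma$ and with coefficients $H_{(n)}$, then for every $n>0$ $$H_{(n)}=\tfrac43\big(\nabla^2+m_{(n)}^2\big)\frac{\omega_{(n)}}{\omega_{(0)}}-f_{(n)}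 .$$ Here - $\nabla^2$ is the Laplace-Beltrami operator of the background metric $\omega_{(0)}^{2/3}g_0$ (so for $\omega_{(0)}\equiv1$ the operator is $\tfrac43(\nabla^2+m^2_{(n)})\omega_{(n)}$ with $\nabla^2$ the Laplacian of $g_0$), and $m_{(n)}^2$ is a real-valued function on $\Sigma$, not necessarily positive, that depends only on the background $g_0,\pi_0,\omega_{(0)}$; - $f_{(n)}$ depends only on $\omega_{(i)}$ for $0\le i<n$ and on $h_{(k)},p_{(k)}$ for $0\le k\le n$, and it is homogeneous of total order $n$ in the perturbations: replacing $\omega_{(i)},h_{(k)},p_{(k)}$ by $s^i\omega_{(i)},s^kh_{(k)},s^kp_{(k)}$ multiplies it by $s^n$, for every real $s$. -/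

import Mathlib

open scoped Manifold ContDiff Topology

namespace ShapeDynamics

noncomputable section

/-- The model space of a three-dimensional manifold. -/
abbrev E3 : Type := EuclideanSpace ℝ (Fin 3)

/-- Component matrices of rank-two tensors in dimension three. -/
abbrev Mat3 : Type := Matrix (Fin 3) (Fin 3) ℝ

/-! ### Riemannian geometry of a coordinate metric on (an open subset of) `ℝ³` -/

/-- The coordinate partial derivative `∂ᵢ f`. -/
def pd (i : Fin 3) (f : E3 → ℝ) (y : E3) : ℝ :=
  fderiv ℝ f y (EuclideanSpace.single i 1)

/-- Christoffel symbols `Γᵏᵢⱼ = ½ gᵏˡ (∂ᵢ gⱼₗ + ∂ⱼ gᵢₗ - ∂ₗ gᵢⱼ)`. -/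
def christoffel (G : E3 → Mat3) (k i j : Fin 3) (y : E3) : ℝ :=
  (1 / 2) * ∑ l, (G y)⁻¹ k l *
    (pd i (fun z => G z j l) y + pd j (fun z => G z i l) y - pd l (fun z => G z i j) y)

/-- Scalar curvature
`R = gⁱʲ (∂ₖ Γᵏᵢⱼ - ∂ⱼ Γᵏᵢₖ + Γᵏᵢⱼ Γˡₖₗ - Γᵏᵢₗ Γˡⱼₖ)`
(positive on round spheres). -/
def coordScalarCurvature (G : E3 → Mat3) (y : E3) : ℝ :=
  ∑ i, ∑ j, (G y)⁻¹ i j *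
    ((∑ k, (pd k (christoffel G k i j) y - pd j (christoffel G k i k) y)) +
      ∑ k, ∑ l, (christoffel G k i j y * christoffel G l k l y
        - christoffel G k i l y * christoffel G l j k y))

/-- Laplace-Beltrami operator `∇² u = gⁱʲ (∂ᵢ ∂ⱼ u - Γᵏᵢⱼ ∂ₖ u)`. -/
def coordLaplacian (G : E3 → Mat3) (u : E3 → ℝ) (y : E3) : ℝ :=
  ∑ i, ∑ j, (G y)⁻¹ i j * (pd i (pd j u) y - ∑ k, christoffel G k i j y * pd k u y)

/-! ### Tensor fields on a three-manifold

The tangent space `TangentSpace (𝓡 3) x` is `ℝ³`, identified through the preferred chart at `x`.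
A rank-two tensor (or tensor density) field is recorded as a function `M → Mat3`, and a scalar
density as a function `M → ℝ`: the value at `x` holds the components at `x` in the preferred
chart at `x`.  The components at `x` in the preferred chart at another point `c` are obtained from
these by the tensor transformation law. -/

section Fields

variable {M : Type*} [TopologicalSpace M] [ChartedSpace E3 M] [IsManifold (𝓡 3) ∞ M]

/-- Jacobian at `x` of the change from the preferred chart at `c` to the preferred chart at `x`. -/
def jac (c x : M) : Mat3 :=
  Matrix.of fun k i => (tangentCoordChange (𝓡 3) c x x (EuclideanSpace.single i 1 : E3) : E3) k

/-- Components `gᵢⱼ`, in the chart at `c`, of a covariant 2-tensor field, as functions of the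
coordinates. -/
def covComp (c : M) (g : M → Mat3) (y : E3) : Mat3 :=
  let x := (extChartAt (𝓡 3) c).symm y
  (jac c x).transpose * g x * jac c x

/-- Components `πⁱʲ`, in the chart at `c`, of a contravariant 2-tensor density of weight one. -/
def densComp (c : M) (π : M → Mat3) (y : E3) : Mat3 :=
  let x := (extChartAt (𝓡 3) c).symm y
  |(jac c x).det| • ((jac c x)⁻¹ * π x * (jac c x)⁻¹.transpose)

/-- The expression, in the chart at `c`, of a scalar density of weight one. -/
def scalarDensComp (c : M) (ρ : M → ℝ) (y : E3) : ℝ :=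
  let x := (extChartAt (𝓡 3) c).symm y
  |(jac c x).det| * ρ x

/-- `g` consists of the components of a smooth Riemannian metric. -/
def IsRiemannianMetric (g : M → Mat3) : Prop :=
  ∃ G : Bundle.ContMDiffRiemannianMetric (𝓡 3) ∞ E3
      (fun x : M => TangentSpace (𝓡 3) x),
    ∀ x i j, g x i j =
      G.inner x (EuclideanSpace.single i 1 : E3) (EuclideanSpace.single j 1 : E3)

/-- The scalar curvature `R[g]`. -/
def scalarCurvature (g : M → Mat3) (x : M) : ℝ :=
  coordScalarCurvature (covComp x g) (extChartAt (𝓡 3) x x)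

/-- The Laplace-Beltrami operator `∇²` of `g` acting on functions. -/
def laplacian (g : M → Mat3) (u : M → ℝ) (x : M) : ℝ :=
  coordLaplacian (covComp x g) (fun y => u ((extChartAt (𝓡 3) x).symm y))
    (extChartAt (𝓡 3) x x)

/-- The volume density `√g`. -/
def sqrtDet (g : M → Mat3) (x : M) : ℝ := Real.sqrt (g x).det

/-- The trace `π = πᵃᵇ g_ab`, a scalar density. -/
def momTrace (g π : M → Mat3) (x : M) : ℝ := ∑ a, ∑ b, π x a b * g x a b

/-- The contraction `π · π = g_ac g_bd πᵃᵇ πᶜᵈ`. -/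
def momSq (g π : M → Mat3) (x : M) : ℝ :=
  ∑ a, ∑ b, ∑ c, ∑ d, g x a c * g x b d * π x a b * π x c d

/-- The undensitized scalar constraint of general relativity in ADM form,
`S / √g` with `S = (π·π - π²/2)/√g - √g (R[g] - 2Λ)`. -/
def scalarConstraint (Λ : ℝ) (g π : M → Mat3) (x : M) : ℝ :=
  ((momSq g π x - momTrace g π x ^ 2 / 2) / sqrtDet g x
    - sqrtDet g x * (scalarCurvature g x - 2 * Λ)) / sqrtDet g x

section Integration

variable (M) [T2Space M] [CompactSpace M]

/-- A smooth partition of unity subordinate to the preferred charts. -/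
def chartPartition : SmoothPartitionOfUnity M (𝓡 3) M Set.univ :=
  (SmoothPartitionOfUnity.exists_isSubordinate_chartAt_source (𝓡 3) M).choose

variable {M}

/-- The integral `∫ d³x ρ` of a scalar density over the compact manifold `M`. -/
def densIntegral (ρ : M → ℝ) : ℝ :=
  ∑ᶠ c : M, ∫ y in (extChartAt (𝓡 3) c).target,
    chartPartition M c ((extChartAt (𝓡 3) c).symm y) * scalarDensComp c ρ y

/-- The mean `⟨π⟩ = ∫ d³x πᵃᵇ g_ab / ∫ d³x √g` of the trace of the momentum. -/
def meanMomTrace (g π : M → Mat3) : ℝ :=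
  densIntegral (momTrace g π) / densIntegral (sqrtDet g)

/-! ### The conformal map `T_φ` -/

/-- `T_φ g = e^{4φ} g`. -/
def confMetric (φ : M → ℝ) (g : M → Mat3) (x : M) : Mat3 := Real.exp (4 * φ x) • g x

/-- `T_φ πᵃᵇ = e^{-4φ} (πᵃᵇ - ⅓ ⟨π⟩ (1 - e^{6φ}) gᵃᵇ √g)`. -/
def confMomentum (φ : M → ℝ) (g π : M → Mat3) (x : M) : Mat3 :=
  Real.exp (-4 * φ x) •
    (π x - ((1 / 3) * meanMomTrace g π * (1 - Real.exp (6 * φ x)) * sqrtDet g x) • (g x)⁻¹)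

/-- `T_φ (S / √g)`: the undensitized scalar constraint at the transformed phase-space point. -/
def transformedConstraint (Λ : ℝ) (φ : M → ℝ) (g π : M → Mat3) (x : M) : ℝ :=
  scalarConstraint Λ (confMetric φ g) (confMomentum φ g π) x

end Integration

/-! ### Perturbative expansions -/

/-- The coefficient of `εⁿ` in the expansion of `f` about `ε = 0`. -/
def epsCoeff (n : ℕ) (f : ℝ → ℝ) : ℝ := iteratedDeriv n f 0 / (n.factorial : ℝ)

/-- A one-parameter family (`|ε| < δ`) of phase-space points `(g_ε, π_ε)` and conformal factors
`φ_ε`, smooth in the parameter and the point together. -/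
structure IsSmoothFamily (δ : ℝ) (g π : ℝ → M → Mat3) (φ : ℝ → M → ℝ) : Prop where
  metric : ∀ ε ∈ Set.Ioo (-δ) δ, IsRiemannianMetric (g ε)
  momentum_symm : ∀ ε ∈ Set.Ioo (-δ) δ, ∀ x, (π ε x).IsSymm
  metric_smooth : ∀ (c : M) (i j : Fin 3),
    ContDiffOn ℝ ∞ (fun p : ℝ × E3 => covComp c (g p.1) p.2 i j)
      (Set.Ioo (-δ) δ ×ˢ (extChartAt (𝓡 3) c).target)
  momentum_smooth : ∀ (c : M) (i j : Fin 3),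
    ContDiffOn ℝ ∞ (fun p : ℝ × E3 => densComp c (π p.1) p.2 i j)
      (Set.Ioo (-δ) δ ×ˢ (extChartAt (𝓡 3) c).target)
  factor_smooth : ∀ c : M,
    ContDiffOn ℝ ∞ (fun p : ℝ × E3 => φ p.1 ((extChartAt (𝓡 3) c).symm p.2))
      (Set.Ioo (-δ) δ ×ˢ (extChartAt (𝓡 3) c).target)

/-- The `n`-th order perturbation of a tensor field: the coefficient of `εⁿ`
(the background for `n = 0`). -/
def tensorCoeff (n : ℕ) (T : ℝ → M → Mat3) (x : M) : Mat3 :=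
  Matrix.of fun i j => epsCoeff n (fun ε => T ε x i j)

/-- `ω₍ₙ₎`: the coefficient of `εⁿ` in `Ω⁶ = e^{6φ}`. -/
def omegaCoeff (n : ℕ) (φ : ℝ → M → ℝ) (x : M) : ℝ :=
  epsCoeff n (fun ε => Real.exp (6 * φ ε x))

/-- `(4/3) (∇² + m²) (w / w₀)`, where `∇²` is the Laplacian of the background metric
`Ω₀⁴ g₀ = w₀^{2/3} g₀`; for `w₀ = 1` this is `(4/3) (∇² + m²) w` with `∇²` that of `g₀`. -/
def linearOperator (g₀ : M → Mat3) (w₀ msq w : M → ℝ) (x : M) : ℝ :=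
  (4 / 3) * (laplacian (fun z => (w₀ z ^ (2 / 3 : ℝ)) • g₀ z) (fun z => w z / w₀ z) x
    + msq x * (w x / w₀ x))

end Fields

end

end ShapeDynamics

/-!
Suppose two families of data have Taylor coefficients in `ε` that agree below order `n`. The
difference of their `n`-th coefficients then behaves like a derivative: sums, products and smooth
functions transform it linearly, with coefficients taken at `ε = 0`. Apply this to the given family
and to the polynomial family built from the coefficients of `(g, π)` up to order `n` and from those
of `Ω⁶` below order `n`. The mean `⟨π⟩` only sees `(g, π)`, so its coefficients of order at most `n`
agree, and the conformal metrics `Ω⁴ g` differ at order `n` by a pointwise rescaling of the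
background. By the Palatini identity the response of the scalar curvature to such a rescaling is a
Laplacian plus a zeroth-order term. Hence the `n`-th coefficients of `T_φ (S / √g)` differ by
`(4/3) (∇² + m²) (ω₍ₙ₎ / ω₍₀₎)`, and `-f₍ₙ₎` is the `n`-th coefficient along the polynomial family.
Its homogeneity is the substitution `ε ↦ s ε`.
-/

namespace ShapeDynamics

noncomputable section

open Asymptotics Filter MeasureTheory

/-! ### Taylor coefficients and their variation -/

section Coefficients

variable {n k : ℕ} {f h : ℝ → ℝ}

theorem epsCoeff_zero (f : ℝ → ℝ) : epsCoeff 0 f = f 0 := by simp [epsCoeff]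

theorem epsCoeff_congr (hfh : f =ᶠ[𝓝 0] h) : epsCoeff k f = epsCoeff k h := by
  simp only [epsCoeff, hfh.iteratedDeriv_eq]

theorem epsCoeff_sub (hf : ContDiffAt ℝ ∞ f 0) (hh : ContDiffAt ℝ ∞ h 0) :
    epsCoeff k (fun ε => f ε - h ε) = epsCoeff k f - epsCoeff k h := by
  have := iteratedDeriv_sub (n := k) (hf.of_le (mod_cast le_top)) (hh.of_le (mod_cast le_top))
  simp only [epsCoeff, ← sub_div, ← this]
  rfl

theorem epsCoeff_add_const (hk : 0 < k) (f : ℝ → ℝ) (a : ℝ) :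
    epsCoeff k (fun ε => f ε + a) = epsCoeff k f := by
  simp only [epsCoeff, add_comm _ a, iteratedDeriv_const_add hk]

theorem epsCoeff_const_mul (k : ℕ) (a : ℝ) (f : ℝ → ℝ) :
    epsCoeff k (fun ε => a * f ε) = a * epsCoeff k f := by
  rw [epsCoeff, iteratedDeriv_const_mul_field, mul_div_assoc, ← epsCoeff]

theorem epsCoeff_sum {ι : Type*} (k : ℕ) {s : Finset ι} {f : ι → ℝ → ℝ}
    (hf : ∀ i ∈ s, ContDiffAt ℝ ∞ (f i) 0) :
    epsCoeff k (fun ε => ∑ i ∈ s, f i ε) = ∑ i ∈ s, epsCoeff k (f i) := by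
  simp only [epsCoeff, ← Finset.sum_fn]
  rw [iteratedDeriv_sum fun i hi => (hf i hi).of_le (mod_cast le_top), Finset.sum_div]

theorem iteratedDeriv_comp_mul_left (k : ℕ) (s : ℝ) (f : ℝ → ℝ) (x : ℝ) :
    iteratedDeriv k (fun ε => f (s * ε)) x = s ^ k * iteratedDeriv k f (s * x) := by
  induction k generalizing x with
  | zero => simp
  | succ k ih =>
    rw [iteratedDeriv_succ, funext ih, deriv_const_mul_field, iteratedDeriv_succ,
      deriv_comp_mul_left s (iteratedDeriv k f), smul_eq_mul, pow_succ, mul_assoc]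

theorem epsCoeff_comp_mul_left (k : ℕ) (s : ℝ) (f : ℝ → ℝ) :
    epsCoeff k (fun ε => f (s * ε)) = s ^ k * epsCoeff k f := by
  rw [epsCoeff, iteratedDeriv_comp_mul_left, mul_zero, mul_div_assoc, ← epsCoeff]

theorem sub_sum_epsCoeff_isLittleO (n : ℕ) (hf : ContDiffAt ℝ ∞ f 0) :
    (fun ε => f ε - ∑ k ∈ Finset.range (n + 1), ε ^ k * epsCoeff k f) =o[𝓝 0]
      fun ε => ε ^ n := by
  obtain ⟨u, hu, hfu⟩ := (hf.of_le (m := n) (mod_cast le_top)).contDiffOn le_rfl (by simp)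
  obtain ⟨r, hr, hru⟩ := Metric.mem_nhds_iff.1 hu
  have h0 := Metric.mem_ball_self (x := (0 : ℝ)) hr
  have h := taylor_isLittleO (convex_ball (0 : ℝ) r) h0 (hfu.mono hru)
  rw [Metric.isOpen_ball.nhdsWithin_eq h0] at h
  simp only [sub_zero] at h
  refine h.congr_left fun ε => ?_
  rw [taylor_within_apply]
  congr 1
  refine Finset.sum_congr rfl fun k _ => ?_
  rw [iteratedDerivWithin_of_isOpen Metric.isOpen_ball h0, epsCoeff, sub_zero, smul_eq_mul]
  ring

theorem eq_zero_of_const_mul_pow_isLittleO {a : ℝ}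
    (h : (fun ε : ℝ => a * ε ^ n) =o[𝓝 0] fun ε => ε ^ n) : a = 0 := by
  by_contra ha
  have hpow : (fun ε : ℝ => ε ^ n) =o[𝓝[≠] 0] fun ε => ε ^ n :=
    ((isLittleO_const_mul_left_iff ha).1 h).mono nhdsWithin_le_nhds
  refine isLittleO_irrefl (Eventually.frequently ?_) hpow
  filter_upwards [self_mem_nhdsWithin] with ε (hε : ε ≠ 0) using pow_ne_zero _ hε

theorem sub_isLittleO_of_epsCoeff_eq_zero (hf : ContDiffAt ℝ ∞ f 0)
    (h0 : ∀ k < n, epsCoeff k f = 0) :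
    (fun ε => f ε - ε ^ n * epsCoeff n f) =o[𝓝 0] fun ε => ε ^ n := by
  refine (sub_sum_epsCoeff_isLittleO n hf).congr_left fun ε => ?_
  rw [Finset.sum_range_succ, Finset.sum_eq_zero, zero_add]
  intro k hk
  rw [h0 k (Finset.mem_range.1 hk), mul_zero]

theorem epsCoeff_eq_zero_of_isLittleO {a : ℝ} (hf : ContDiffAt ℝ ∞ f 0)
    (h : (fun ε => f ε - ε ^ n * a) =o[𝓝 0] fun ε => ε ^ n) : ∀ k < n, epsCoeff k f = 0 := by
  intro k
  induction k using Nat.strong_induction_on with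
  | _ k ih =>
    intro hk
    have hnk : (fun ε : ℝ => ε ^ n) =o[𝓝 0] fun ε => ε ^ k := isLittleO_pow_pow hk
    have hfk : f =o[𝓝 0] fun ε => ε ^ k :=
      ((h.trans hnk).add (hnk.const_mul_left a)).congr_left fun ε => by ring
    refine eq_zero_of_const_mul_pow_isLittleO (n := k) ?_
    exact (hfk.sub (sub_isLittleO_of_epsCoeff_eq_zero hf fun j hj =>
      ih j hj (hj.trans hk))).congr_left fun ε => by ring

theorem epsCoeff_eq_of_isLittleO {a : ℝ} (hf : ContDiffAt ℝ ∞ f 0)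
    (h : (fun ε => f ε - ε ^ n * a) =o[𝓝 0] fun ε => ε ^ n) : epsCoeff n f = a := by
  have hn := sub_isLittleO_of_epsCoeff_eq_zero hf (epsCoeff_eq_zero_of_isLittleO hf h)
  exact sub_eq_zero.1 (eq_zero_of_const_mul_pow_isLittleO (n := n)
    ((h.sub hn).congr_left fun ε => by ring))

end Coefficients

section Variation

variable {V W : Type*} [NormedAddCommGroup V] [NormedSpace ℝ V] [NormedAddCommGroup W]
  [NormedSpace ℝ W]

/-- The smooth curves `c₁` and `c₂` agree below order `n` at the origin, and `d` is the difference
of their coefficients of order `n`. This behaves like a derivative and computes how the `n`-th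
coefficient of an expression responds to a change of the `n`-th coefficients of its ingredients. -/
structure HasVariation (n : ℕ) (c₁ c₂ : ℝ → V) (d : V) : Prop where
  contDiffAt_left : ContDiffAt ℝ ∞ c₁ 0
  contDiffAt_right : ContDiffAt ℝ ∞ c₂ 0
  isLittleO : (fun ε => c₁ ε - c₂ ε - ε ^ n • d) =o[𝓝 0] fun ε => ε ^ n

namespace HasVariation

variable {n : ℕ} {c₁ c₂ e₁ e₂ : ℝ → V} {d d' : V}

theorem congr (h : HasVariation n c₁ c₂ d) (h₁ : c₁ =ᶠ[𝓝 0] e₁) (h₂ : c₂ =ᶠ[𝓝 0] e₂) :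
    HasVariation n e₁ e₂ d where
  contDiffAt_left := h.contDiffAt_left.congr_of_eventuallyEq h₁.symm
  contDiffAt_right := h.contDiffAt_right.congr_of_eventuallyEq h₂.symm
  isLittleO := h.isLittleO.congr' (by filter_upwards [h₁, h₂] with ε hε₁ hε₂; rw [hε₁, hε₂])
    EventuallyEq.rfl

theorem refl (h : ContDiffAt ℝ ∞ c₁ 0) : HasVariation n c₁ c₁ 0 :=
  ⟨h, h, by simp⟩

theorem congr_variation (h : HasVariation n c₁ c₂ d) (hd : d = d') : HasVariation n c₁ c₂ d' :=
  hd ▸ h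

theorem symm (h : HasVariation n c₁ c₂ d) : HasVariation n c₂ c₁ (-d) where
  contDiffAt_left := h.contDiffAt_right
  contDiffAt_right := h.contDiffAt_left
  isLittleO := h.isLittleO.neg_left.congr_left fun ε => by rw [smul_neg]; abel

theorem add (hc : HasVariation n c₁ c₂ d) (he : HasVariation n e₁ e₂ d') :
    HasVariation n (fun ε => c₁ ε + e₁ ε) (fun ε => c₂ ε + e₂ ε) (d + d') where
  contDiffAt_left := hc.contDiffAt_left.add he.contDiffAt_left
  contDiffAt_right := hc.contDiffAt_right.add he.contDiffAt_right
  isLittleO := (hc.isLittleO.add he.isLittleO).congr_left fun ε => by rw [smul_add]; abel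

theorem sub (hc : HasVariation n c₁ c₂ d) (he : HasVariation n e₁ e₂ d') :
    HasVariation n (fun ε => c₁ ε - e₁ ε) (fun ε => c₂ ε - e₂ ε) (d - d') where
  contDiffAt_left := hc.contDiffAt_left.sub he.contDiffAt_left
  contDiffAt_right := hc.contDiffAt_right.sub he.contDiffAt_right
  isLittleO := (hc.isLittleO.sub he.isLittleO).congr_left fun ε => by rw [smul_sub]; abel

theorem sum {ι : Type*} {s : Finset ι} {c₁ c₂ : ι → ℝ → V} {d : ι → V}
    (h : ∀ i ∈ s, HasVariation n (c₁ i) (c₂ i) (d i)) :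
    HasVariation n (fun ε => ∑ i ∈ s, c₁ i ε) (fun ε => ∑ i ∈ s, c₂ i ε) (∑ i ∈ s, d i) where
  contDiffAt_left := ContDiffAt.sum fun i hi => (h i hi).contDiffAt_left
  contDiffAt_right := ContDiffAt.sum fun i hi => (h i hi).contDiffAt_right
  isLittleO := (IsLittleO.sum fun i hi => (h i hi).isLittleO).congr_left fun ε => by
    simp only [Finset.sum_apply, Finset.sum_sub_distrib, Finset.smul_sum]

theorem prodMk {e₁ e₂ : ℝ → W} {d' : W} (hc : HasVariation n c₁ c₂ d)
    (he : HasVariation n e₁ e₂ d') :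
    HasVariation n (fun ε => (c₁ ε, e₁ ε)) (fun ε => (c₂ ε, e₂ ε)) (d, d') where
  contDiffAt_left := hc.contDiffAt_left.prodMk he.contDiffAt_left
  contDiffAt_right := hc.contDiffAt_right.prodMk he.contDiffAt_right
  isLittleO := hc.isLittleO.prod_left he.isLittleO

theorem sub_isBigO (h : HasVariation n c₁ c₂ d) :
    (fun ε => c₁ ε - c₂ ε) =O[𝓝 0] fun ε => ε ^ n :=
  (h.isLittleO.isBigO.add (IsBigO.of_bound ‖d‖ (.of_forall fun ε => by
    rw [norm_smul, mul_comm]))).congr_left fun ε => sub_add_cancel _ (ε ^ n • d)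

theorem apply_zero_eq [NeZero n] (h : HasVariation n c₁ c₂ d) : c₁ 0 = c₂ 0 :=
  sub_eq_zero.1 (h.sub_isBigO.eq_zero_imp.self_of_nhds (zero_pow (NeZero.ne n)))

theorem comp [NeZero n] {F : V → W} {F' : V →L[ℝ] W} (h : HasVariation n c₁ c₂ d)
    (hF : ContDiffAt ℝ ∞ F (c₁ 0)) (hF' : HasFDerivAt F F' (c₁ 0)) :
    HasVariation n (fun ε => F (c₁ ε)) (fun ε => F (c₂ ε)) (F' d) where
  contDiffAt_left := hF.comp 0 h.contDiffAt_left
  contDiffAt_right := ContDiffAt.comp 0 (h.apply_zero_eq ▸ hF) h.contDiffAt_right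
  isLittleO := by
    have hs : HasStrictFDerivAt F F' (c₁ 0) := hF.hasStrictFDerivAt' hF' (by simp)
    have ht : Tendsto (fun ε => (c₁ ε, c₂ ε)) (𝓝 0) (𝓝 (c₁ 0, c₁ 0)) := by
      have h₂ := h.contDiffAt_right.continuousAt.tendsto
      rw [← h.apply_zero_eq] at h₂
      exact h.contDiffAt_left.continuousAt.tendsto.prodMk_nhds h₂
    refine (((hs.isLittleO.comp_tendsto ht).trans_isBigO h.sub_isBigO).add
      ((F'.isBigO_comp _ _).trans_isLittleO h.isLittleO)).congr_left fun ε => ?_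
    simp only [Function.comp, map_sub, map_smul]
    abel

theorem comp_zero [NeZero n] {F : V → W} (h : HasVariation n c₁ c₂ 0)
    (hF : ContDiffAt ℝ ∞ F (c₁ 0)) :
    HasVariation n (fun ε => F (c₁ ε)) (fun ε => F (c₂ ε)) 0 :=
  (h.comp hF (hF.differentiableAt (by simp)).hasFDerivAt).congr_variation (map_zero _)

end HasVariation

namespace HasVariation

variable {n : ℕ} {c₁ c₂ e₁ e₂ : ℝ → ℝ} {d d' : ℝ}

theorem mul [NeZero n] (hc : HasVariation n c₁ c₂ d) (he : HasVariation n e₁ e₂ d') :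
    HasVariation n (fun ε => c₁ ε * e₁ ε) (fun ε => c₂ ε * e₂ ε) (d * e₁ 0 + c₁ 0 * d') := by
  have h := (hc.prodMk he).comp (F := fun p : ℝ × ℝ => p.1 * p.2) (by fun_prop)
    (hasFDerivAt_fst.mul hasFDerivAt_snd)
  refine h.congr_variation ?_
  simp only [add_apply, smul_apply, ContinuousLinearMap.coe_fst', ContinuousLinearMap.coe_snd',
    smul_eq_mul]
  ring

theorem const_mul (a : ℝ) (h : HasVariation n c₁ c₂ d) :
    HasVariation n (fun ε => a * c₁ ε) (fun ε => a * c₂ ε) (a * d) where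
  contDiffAt_left := contDiffAt_const.mul h.contDiffAt_left
  contDiffAt_right := contDiffAt_const.mul h.contDiffAt_right
  isLittleO := (h.isLittleO.const_mul_left a).congr_left fun ε => by
    simp only [smul_eq_mul]
    ring

theorem comp_hasDerivAt [NeZero n] {F : ℝ → ℝ} {F' : ℝ} (h : HasVariation n c₁ c₂ d)
    (hF : ContDiffAt ℝ ∞ F (c₁ 0)) (hF' : HasDerivAt F F' (c₁ 0)) :
    HasVariation n (fun ε => F (c₁ ε)) (fun ε => F (c₂ ε)) (d * F') := by
  simpa using h.comp hF hF'.hasFDerivAt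

theorem inv [NeZero n] (h : HasVariation n c₁ c₂ d) (h0 : c₁ 0 ≠ 0) :
    HasVariation n (fun ε => (c₁ ε)⁻¹) (fun ε => (c₂ ε)⁻¹) (-d / c₁ 0 ^ 2) := by
  convert h.comp_hasDerivAt (contDiffAt_inv ℝ h0) (hasDerivAt_inv h0) using 1
  ring

theorem div [NeZero n] (hc : HasVariation n c₁ c₂ d) (he : HasVariation n e₁ e₂ d')
    (h0 : e₁ 0 ≠ 0) :
    HasVariation n (fun ε => c₁ ε / e₁ ε) (fun ε => c₂ ε / e₂ ε)
      (d / e₁ 0 - c₁ 0 * d' / e₁ 0 ^ 2) := by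
  simp only [div_eq_mul_inv (c₁ _), div_eq_mul_inv (c₂ _)]
  exact (hc.mul (he.inv h0)).congr_variation (by ring)

end HasVariation

theorem hasVariation_iff {n : ℕ} {c₁ c₂ : ℝ → ℝ} {d : ℝ} :
    HasVariation n c₁ c₂ d ↔ ContDiffAt ℝ ∞ c₁ 0 ∧ ContDiffAt ℝ ∞ c₂ 0 ∧
    (∀ k < n, epsCoeff k c₁ = epsCoeff k c₂) ∧ epsCoeff n c₁ - epsCoeff n c₂ = d := by
  constructor
  · rintro ⟨h₁, h₂, h⟩
    refine ⟨h₁, h₂, fun k hk => ?_, ?_⟩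
    · rw [← sub_eq_zero, ← epsCoeff_sub h₁ h₂]
      exact epsCoeff_eq_zero_of_isLittleO (h₁.sub h₂) h k hk
    · rw [← epsCoeff_sub h₁ h₂]
      exact epsCoeff_eq_of_isLittleO (h₁.sub h₂) h
  · rintro ⟨h₁, h₂, hlow, rfl⟩
    refine ⟨h₁, h₂, ?_⟩
    have h := sub_isLittleO_of_epsCoeff_eq_zero (h₁.sub h₂) (n := n) fun k hk => by
      have := epsCoeff_sub (k := k) h₁ h₂
      rwa [hlow k hk, sub_self] at this
    rwa [← epsCoeff_sub h₁ h₂]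

end Variation

section MatrixInverse

variable {E : Type*} [NormedAddCommGroup E] [NormedSpace ℝ E] {ι : Type*} [Fintype ι]
  [DecidableEq ι]

theorem contDiffAt_matrix_det {A : E → Matrix ι ι ℝ} {p : E}
    (hA : ∀ i j, ContDiffAt ℝ ∞ (fun q => A q i j) p) :
    ContDiffAt ℝ ∞ (fun q => (A q).det) p := by
  simp only [Matrix.det_apply]
  exact ContDiffAt.sum fun σ _ => (contDiffAt_prod fun i _ => hA _ _).const_smul _

theorem contDiffAt_matrix_inv {A : E → Matrix ι ι ℝ} {p : E}
    (hA : ∀ i j, ContDiffAt ℝ ∞ (fun q => A q i j) p) (hdet : (A p).det ≠ 0) (i j : ι) :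
    ContDiffAt ℝ ∞ (fun q => (A q)⁻¹ i j) p := by
  simp only [Matrix.inv_def, Matrix.smul_apply, Ring.inverse_eq_inv', smul_eq_mul,
    Matrix.adjugate_apply]
  refine ((contDiffAt_matrix_det hA).inv hdet).mul (contDiffAt_matrix_det fun a b => ?_)
  by_cases hab : a = j
  · subst hab
    simpa only [Matrix.updateRow_self] using contDiffAt_const
  · simpa only [Matrix.updateRow_ne hab] using hA a b

theorem contDiffOn_matrix_inv {A : E → Matrix ι ι ℝ} {U : Set E} (hU : IsOpen U)
    (hA : ∀ i j, ContDiffOn ℝ ∞ (fun q => A q i j) U) (hdet : ∀ q ∈ U, (A q).det ≠ 0) (i j : ι) :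
    ContDiffOn ℝ ∞ (fun q => (A q)⁻¹ i j) U := fun q hq =>
  (contDiffAt_matrix_inv (fun a b => (hA a b).contDiffAt (hU.mem_nhds hq))
    (hdet q hq) i j).contDiffWithinAt

theorem HasVariation.matrix_inv {n : ℕ} [NeZero n] {A₁ A₂ : ℝ → Matrix ι ι ℝ} {D : Matrix ι ι ℝ}
    (h : ∀ i j, HasVariation n (fun ε => A₁ ε i j) (fun ε => A₂ ε i j) (D i j))
    (hdet : (A₁ 0).det ≠ 0) (i j : ι) :
    HasVariation n (fun ε => (A₁ ε)⁻¹ i j) (fun ε => (A₂ ε)⁻¹ i j)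
      (-((A₁ 0)⁻¹ * D * (A₁ 0)⁻¹) i j) := by
  have h0 : A₁ 0 = A₂ 0 := Matrix.ext fun a b => (h a b).apply_zero_eq
  have hs₁ a b := (h a b).contDiffAt_left
  have hs₂ a b := (h a b).contDiffAt_right
  have hinv₁ a b := HasVariation.refl (n := n) (contDiffAt_matrix_inv hs₁ hdet a b)
  have hinv₂ a b := HasVariation.refl (n := n) (contDiffAt_matrix_inv hs₂ (h0 ▸ hdet) a b)
  -- `A₁⁻¹ = A₁⁻¹ A₂ A₂⁻¹` and `A₂⁻¹ = A₁⁻¹ A₁ A₂⁻¹` differ only in the middle factor.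
  have key := HasVariation.sum (s := Finset.univ) fun b _ => (HasVariation.sum
    (s := Finset.univ) fun a _ => (hinv₁ i a).mul (h a b).symm).mul (hinv₂ b j)
  refine (key.congr ?_ ?_).congr_variation ?_
  · filter_upwards [(contDiffAt_matrix_det hs₂).continuousAt.eventually_ne (h0 ▸ hdet)] with ε hε
    simp only [← Matrix.mul_apply, Matrix.mul_nonsing_inv_cancel_right _ _ hε.isUnit]
  · filter_upwards [(contDiffAt_matrix_det hs₁).continuousAt.eventually_ne hdet] with ε hε
    simp only [← Matrix.mul_apply, Matrix.nonsing_inv_mul _ hε.isUnit, Matrix.one_mul]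
  · simp [Matrix.mul_apply, ← h0]

end MatrixInverse

section JointSmoothness

variable {E : Type*} [NormedAddCommGroup E] [NormedSpace ℝ E]

/-- The family `A ε` of functions on `U`, with parameter `ε ∈ I`, is smooth in the parameter and
the point together. -/
abbrev JointlySmoothOn (I : Set ℝ) (U : Set E) (A : ℝ → E → ℝ) : Prop :=
  ContDiffOn ℝ ∞ (fun p : ℝ × E => A p.1 p.2) (I ×ˢ U)

variable {I : Set ℝ} {U : Set E} {A : ℝ → E → ℝ} {ε : ℝ} {y : E}

namespace JointlySmoothOn

theorem contDiffAt_uncurry (hA : JointlySmoothOn I U A) (hI : IsOpen I) (hU : IsOpen U)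
    (hε : ε ∈ I) (hy : y ∈ U) : ContDiffAt ℝ ∞ (fun p : ℝ × E => A p.1 p.2) (ε, y) :=
  hA.contDiffAt ((hI.prod hU).mem_nhds ⟨hε, hy⟩)

theorem contDiffAt_param (hA : JointlySmoothOn I U A) (hI : IsOpen I) (hε : ε ∈ I) (hy : y ∈ U) :
    ContDiffAt ℝ ∞ (fun e => A e y) ε :=
  ContDiffOn.contDiffAt (hA.comp (contDiffOn_id.prodMk contDiffOn_const) fun _ he => ⟨he, hy⟩)
    (hI.mem_nhds hε)

theorem contDiffOn (hA : JointlySmoothOn I U A) (hε : ε ∈ I) : ContDiffOn ℝ ∞ (A ε) U :=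
  hA.comp (contDiffOn_const.prodMk contDiffOn_id) fun _ hz => ⟨hε, hz⟩

theorem fderiv_apply_eq (hA : JointlySmoothOn I U A) (hI : IsOpen I) (hU : IsOpen U) (hε : ε ∈ I)
    (hy : y ∈ U) (v : E) :
    fderiv ℝ (A ε) y v = fderiv ℝ (fun p : ℝ × E => A p.1 p.2) (ε, y) (0, v) := by
  have hd := (hA.contDiffAt_uncurry hI hU hε hy).differentiableAt (by simp)
  have h : HasFDerivAt (A ε) _ y := hd.hasFDerivAt.comp y (hasFDerivAt_prodMk_right (𝕜 := ℝ) ε y)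
  simp [h.fderiv]

theorem deriv_eq (hA : JointlySmoothOn I U A) (hI : IsOpen I) (hU : IsOpen U) (hε : ε ∈ I)
    (hy : y ∈ U) :
    deriv (fun e => A e y) ε = fderiv ℝ (fun p : ℝ × E => A p.1 p.2) (ε, y) (1, 0) := by
  have hd := (hA.contDiffAt_uncurry hI hU hε hy).differentiableAt (by simp)
  exact (hd.hasFDerivAt.comp_hasDerivAt ε
    (((hasDerivAt_id ε).prodMk (hasDerivAt_const ε y)))).deriv

theorem fderiv_apply (hA : JointlySmoothOn I U A) (hI : IsOpen I) (hU : IsOpen U) (v : E) :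
    JointlySmoothOn I U fun ε y => fderiv ℝ (A ε) y v :=
  ((hA.fderiv_of_isOpen (hI.prod hU) (by simp)).clm_apply contDiffOn_const).congr
    fun _ hp => hA.fderiv_apply_eq hI hU hp.1 hp.2 v

theorem deriv_param (hA : JointlySmoothOn I U A) (hI : IsOpen I) (hU : IsOpen U) :
    JointlySmoothOn I U fun ε y => deriv (fun e => A e y) ε :=
  ((hA.fderiv_of_isOpen (hI.prod hU) (by simp)).clm_apply contDiffOn_const).congr
    fun _ hp => hA.deriv_eq hI hU hp.1 hp.2

theorem deriv_fderiv_apply_comm (hA : JointlySmoothOn I U A) (hI : IsOpen I) (hU : IsOpen U)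
    (hε : ε ∈ I) (hy : y ∈ U) (v : E) :
    deriv (fun e => fderiv ℝ (A e) y v) ε =
      fderiv ℝ (fun z => deriv (fun e => A e z) ε) y v := by
  set B : ℝ × E → ℝ := fun p => A p.1 p.2
  have hB : ContDiffAt ℝ ∞ B (ε, y) := hA.contDiffAt_uncurry hI hU hε hy
  have hd : DifferentiableAt ℝ (fderiv ℝ B) (ε, y) :=
    (hB.fderiv_right (m := ∞) (by simp)).differentiableAt (by simp)
  have hnhds : I ×ˢ U ∈ 𝓝 (ε, y) := (hI.prod hU).mem_nhds ⟨hε, hy⟩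
  have hfderiv : (fun p : ℝ × E => fderiv ℝ (A p.1) p.2 v) =ᶠ[𝓝 (ε, y)]
      fun p => fderiv ℝ B p (0, v) := by
    filter_upwards [hnhds] with p hp using hA.fderiv_apply_eq hI hU hp.1 hp.2 v
  have hderiv : (fun p : ℝ × E => deriv (fun e => A e p.2) p.1) =ᶠ[𝓝 (ε, y)]
      fun p => fderiv ℝ B p (1, 0) := by
    filter_upwards [hnhds] with p hp using hA.deriv_eq hI hU hp.1 hp.2
  have hsecond (u w : ℝ × E) : fderiv ℝ (fun p => fderiv ℝ B p u) (ε, y) w =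
      fderiv ℝ (fderiv ℝ B) (ε, y) w u := by
    simp [fderiv_clm_apply hd (differentiableAt_const u)]
  rw [(hA.fderiv_apply hI hU v).deriv_eq hI hU hε hy,
    (hA.deriv_param hI hU).fderiv_apply_eq hI hU hε hy,
    hfderiv.fderiv_eq, hderiv.fderiv_eq, hsecond, hsecond]
  refine (hB.isSymmSndFDerivAt ?_).eq _ _
  rw [minSmoothness_of_isRCLikeNormedField]
  exact (WithTop.coe_le_coe.2 le_top : ((2 : ℕ∞) : WithTop ℕ∞) ≤ ∞)

theorem iteratedDeriv_param (hA : JointlySmoothOn I U A) (hI : IsOpen I) (hU : IsOpen U) (k : ℕ) :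
    JointlySmoothOn I U fun ε y => iteratedDeriv k (fun e => A e y) ε := by
  induction k with
  | zero => simpa using hA
  | succ k ih => simpa only [iteratedDeriv_succ] using ih.deriv_param hI hU

theorem iteratedDeriv_fderiv_apply_comm (hA : JointlySmoothOn I U A) (hI : IsOpen I)
    (hU : IsOpen U) (hε : ε ∈ I) (hy : y ∈ U) (v : E) (k : ℕ) :
    iteratedDeriv k (fun e => fderiv ℝ (A e) y v) ε =
      fderiv ℝ (fun z => iteratedDeriv k (fun e => A e z) ε) y v := by
  induction k generalizing ε with
  | zero => simp
  | succ k ih =>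
    simp only [iteratedDeriv_succ]
    have hk : iteratedDeriv k (fun e => fderiv ℝ (A e) y v) =ᶠ[𝓝 ε]
        fun e => fderiv ℝ (fun z => iteratedDeriv k (fun e => A e z) e) y v := by
      filter_upwards [hI.mem_nhds hε] with e he using ih he
    rw [hk.deriv_eq]
    exact (hA.iteratedDeriv_param hI hU k).deriv_fderiv_apply_comm hI hU hε hy v

theorem contDiffOn_epsCoeff (hA : JointlySmoothOn I U A) (hI : IsOpen I) (h0 : 0 ∈ I)
    (hU : IsOpen U) (k : ℕ) : ContDiffOn ℝ ∞ (fun z => epsCoeff k fun e => A e z) U :=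
  ((hA.iteratedDeriv_param hI hU k).contDiffOn h0).div_const _

theorem epsCoeff_fderiv_apply (hA : JointlySmoothOn I U A) (hI : IsOpen I) (h0 : 0 ∈ I)
    (hU : IsOpen U) (hy : y ∈ U) (v : E) (k : ℕ) :
    epsCoeff k (fun e => fderiv ℝ (A e) y v) =
      fderiv ℝ (fun z => epsCoeff k fun e => A e z) y v := by
  simp only [epsCoeff, hA.iteratedDeriv_fderiv_apply_comm hI hU h0 hy, div_eq_inv_mul]
  rw [fderiv_const_mul ((((hA.iteratedDeriv_param hI hU k).contDiffOn h0).contDiffAt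
    (hU.mem_nhds hy)).differentiableAt (by simp)), smul_apply, smul_eq_mul]

end JointlySmoothOn

theorem HasVariation.fderiv_apply {n : ℕ} {A₁ A₂ : ℝ → E → ℝ} {d : E → ℝ}
    (h : ∀ z ∈ U, HasVariation n (fun ε => A₁ ε z) (fun ε => A₂ ε z) (d z))
    (hI : IsOpen I) (h0 : 0 ∈ I) (hU : IsOpen U) (h₁ : JointlySmoothOn I U A₁)
    (h₂ : JointlySmoothOn I U A₂) (hy : y ∈ U) (v : E) :
    HasVariation n (fun ε => fderiv ℝ (A₁ ε) y v) (fun ε => fderiv ℝ (A₂ ε) y v)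
      (fderiv ℝ d y v) := by
  have hcoeff := fun z hz => hasVariation_iff.1 (h z hz)
  refine hasVariation_iff.2 ⟨(h₁.fderiv_apply hI hU v).contDiffAt_param hI h0 hy,
    (h₂.fderiv_apply hI hU v).contDiffAt_param hI h0 hy, fun k hk => ?_, ?_⟩
  · rw [h₁.epsCoeff_fderiv_apply hI h0 hU hy, h₂.epsCoeff_fderiv_apply hI h0 hU hy]
    have hk : (fun z => epsCoeff k fun e => A₁ e z) =ᶠ[𝓝 y]
        fun z => epsCoeff k fun e => A₂ e z := by
      filter_upwards [hU.mem_nhds hy] with z hz using (hcoeff z hz).2.2.1 k hk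
    rw [hk.fderiv_eq]
  · rw [h₁.epsCoeff_fderiv_apply hI h0 hU hy, h₂.epsCoeff_fderiv_apply hI h0 hU hy]
    have hd : d =ᶠ[𝓝 y]
        fun z => (epsCoeff n fun e => A₁ e z) - epsCoeff n fun e => A₂ e z := by
      filter_upwards [hU.mem_nhds hy] with z hz using (hcoeff z hz).2.2.2.symm
    have hdiff {A : ℝ → E → ℝ} (hA : JointlySmoothOn I U A) :
        DifferentiableAt ℝ (fun z => epsCoeff n fun e => A e z) y :=
      ((hA.contDiffOn_epsCoeff hI h0 hU n).contDiffAt (hU.mem_nhds hy)).differentiableAt (by simp)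
    rw [hd.fderiv_eq, fderiv_fun_sub (hdiff h₁) (hdiff h₂), sub_apply]

theorem HasVariation.contDiffOn_variation {n : ℕ} {A₁ A₂ : ℝ → E → ℝ} {d : E → ℝ}
    (h : ∀ z ∈ U, HasVariation n (fun ε => A₁ ε z) (fun ε => A₂ ε z) (d z))
    (hI : IsOpen I) (h0 : 0 ∈ I) (hU : IsOpen U) (h₁ : JointlySmoothOn I U A₁)
    (h₂ : JointlySmoothOn I U A₂) : ContDiffOn ℝ ∞ d U :=
  ((h₁.contDiffOn_epsCoeff hI h0 hU n).sub (h₂.contDiffOn_epsCoeff hI h0 hU n)).congr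
    fun z hz => (hasVariation_iff.1 (h z hz)).2.2.2.symm

end JointSmoothness

/-! ### Levi-Civita connection and curvature in coordinates -/

section PartialDerivatives

variable {f h : E3 → ℝ} {y : E3} {U : Set E3} (i : Fin 3)

theorem pd_congr_of_isOpen (hU : IsOpen U) (hy : y ∈ U) (hfh : Set.EqOn f h U) :
    pd i f y = pd i h y := by
  rw [pd, pd, (hfh.eventuallyEq_of_mem (hU.mem_nhds hy)).fderiv_eq]

theorem pd_mul (hf : DifferentiableAt ℝ f y) (hh : DifferentiableAt ℝ h y) :
    pd i (fun z => f z * h z) y = pd i f y * h y + f y * pd i h y := by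
  simp only [pd, fderiv_fun_mul hf hh, add_apply, smul_apply, smul_eq_mul]
  ring

theorem pd_const_mul (a : ℝ) (f : E3 → ℝ) (y : E3) :
    pd i (fun z => a * f z) y = a * pd i f y :=
  DFunLike.congr_fun (congrFun (fderiv_const_smul_field (𝕜 := ℝ) (f := f) a) y) _

theorem pd_sum {ι : Type*} (s : Finset ι) {F : ι → E3 → ℝ}
    (hF : ∀ a ∈ s, DifferentiableAt ℝ (F a) y) :
    pd i (fun z => ∑ a ∈ s, F a z) y = ∑ a ∈ s, pd i (F a) y := by
  simp only [pd, fderiv_fun_sum hF, sum_apply]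

theorem contDiffOn_pd (hU : IsOpen U) (hf : ContDiffOn ℝ ∞ f U) : ContDiffOn ℝ ∞ (pd i f) U :=
  (hf.fderiv_of_isOpen hU (by simp)).clm_apply contDiffOn_const

theorem differentiableAt_of_contDiffOn (hU : IsOpen U) (hf : ContDiffOn ℝ ∞ f U) (hy : y ∈ U) :
    DifferentiableAt ℝ f y :=
  (hf.contDiffAt (hU.mem_nhds hy)).differentiableAt (by simp)

end PartialDerivatives

/-- A smooth nondegenerate symmetric matrix field on `U`: a coordinate expression of a
pseudo-Riemannian metric. -/
structure IsMetricOn (U : Set E3) (G : E3 → Mat3) : Prop where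
  symm : ∀ z ∈ U, (G z).IsSymm
  det_ne_zero : ∀ z ∈ U, (G z).det ≠ 0
  contDiffOn : ∀ i j, ContDiffOn ℝ ∞ (fun z => G z i j) U

/-- The divergence `∇ₖ Vᵏ` of a vector field. -/
def coordDivergence (G : E3 → Mat3) (V : Fin 3 → E3 → ℝ) (y : E3) : ℝ :=
  ∑ k, (pd k (V k) y + ∑ l, christoffel G l k l y * V k y)

/-- The divergence `gⁱʲ ∇ᵢ uⱼ` of a covector field; the Laplacian of a function is that of its
differential. -/
def coordCodivergence (G : E3 → Mat3) (u : Fin 3 → E3 → ℝ) (y : E3) : ℝ :=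
  ∑ i, ∑ j, (G y)⁻¹ i j * (pd i (u j) y - ∑ k, christoffel G k i j y * u k y)

/-- The linearization, along a change `T` of the connection, of the expression of the Ricci tensor
in terms of the Christoffel symbols. -/
def ricciVariation (G : E3 → Mat3) (T : Fin 3 → Fin 3 → Fin 3 → E3 → ℝ) (i j : Fin 3) (y : E3) :
    ℝ :=
  (∑ k, (pd k (T k i j) y - pd j (T k i k) y)) +
    ∑ k, ∑ l, (T k i j y * christoffel G l k l y + christoffel G k i j y * T l k l y
      - (T k i l y * christoffel G l j k y + christoffel G k i l y * T l j k y))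

namespace IsMetricOn

variable {U : Set E3} {G : E3 → Mat3} {y : E3}

theorem inv_symm (hG : IsMetricOn U G) (hy : y ∈ U) (i j : Fin 3) :
    (G y)⁻¹ i j = (G y)⁻¹ j i := by
  have h := Matrix.transpose_nonsing_inv (G y)
  rw [hG.symm y hy] at h
  exact congrFun₂ h j i

theorem contDiffOn_inv (hG : IsMetricOn U G) (hU : IsOpen U) (i j : Fin 3) :
    ContDiffOn ℝ ∞ (fun z => (G z)⁻¹ i j) U :=
  contDiffOn_matrix_inv hU hG.contDiffOn hG.det_ne_zero i j

theorem christoffel_symm (hG : IsMetricOn U G) (hU : IsOpen U) (hy : y ∈ U) (k i j : Fin 3) :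
    christoffel G k i j y = christoffel G k j i y := by
  have hsymm (l : Fin 3) : pd l (fun z => G z i j) y = pd l (fun z => G z j i) y :=
    pd_congr_of_isOpen l hU hy fun z hz => (hG.symm z hz).apply j i
  simp only [christoffel, hsymm, add_comm (pd i _ y)]

theorem pd_inv (hG : IsMetricOn U G) (hU : IsOpen U) (hy : y ∈ U) (m i j : Fin 3) :
    pd m (fun z => (G z)⁻¹ i j) y =
      -((G y)⁻¹ * Matrix.of (fun a b => pd m (fun z => G z a b) y) * (G y)⁻¹) i j := by
  have hd (a b) := differentiableAt_of_contDiffOn hU (hG.contDiffOn a b) hy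
  have hdi (a b) := differentiableAt_of_contDiffOn hU (hG.contDiffOn_inv hU a b) hy
  -- Differentiate `G⁻¹ G = 1`.
  have hprod : Matrix.of (fun a b => pd m (fun z => (G z)⁻¹ a b) y) * G y +
      (G y)⁻¹ * Matrix.of (fun a b => pd m (fun z => G z a b) y) = 0 := by
    ext a b
    have h : pd m (fun z => ∑ c, (G z)⁻¹ a c * G z c b) y = 0 := by
      rw [pd_congr_of_isOpen m hU hy (h := fun _ => (1 : Mat3) a b), pd, fderiv_fun_const]
      · rfl
      · intro z hz
        simp only [← Matrix.mul_apply, Matrix.nonsing_inv_mul _ (hG.det_ne_zero z hz).isUnit]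
    rw [pd_sum _ _ fun c _ => (hdi a c).fun_mul (hd c b)] at h
    simp only [pd_mul m (hdi a _) (hd _ b), Finset.sum_add_distrib] at h
    exact h
  have h := congrArg (· * (G y)⁻¹) (eq_neg_of_add_eq_zero_left hprod)
  simp only [Matrix.mul_nonsing_inv_cancel_right _ _ (hG.det_ne_zero y hy).isUnit,
    Matrix.neg_mul] at h
  exact congrFun₂ h i j

theorem pd_inv_eq_christoffel (hG : IsMetricOn U G) (hU : IsOpen U) (hy : y ∈ U)
    (m i j : Fin 3) :
    pd m (fun z => (G z)⁻¹ i j) y =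
      -∑ a, (christoffel G i m a y * (G y)⁻¹ a j + christoffel G j m a y * (G y)⁻¹ a i) := by
  have hpd (l a b : Fin 3) : pd l (fun z => G z a b) y = pd l (fun z => G z b a) y :=
    pd_congr_of_isOpen l hU hy fun z hz => (hG.symm z hz).apply b a
  have hinv := hG.inv_symm hy
  simp only [hG.pd_inv hU hy, christoffel, Matrix.mul_apply, Matrix.of_apply, Fin.sum_univ_three,
    hpd _ 1 0, hpd _ 2 0, hpd _ 2 1, hinv i, hinv j]
  ring

theorem coordDivergence_raise (hG : IsMetricOn U G) (hU : IsOpen U) (hy : y ∈ U)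
    {u : Fin 3 → E3 → ℝ} (hu : ∀ j, DifferentiableAt ℝ (u j) y) :
    coordDivergence G (fun i z => ∑ j, (G z)⁻¹ i j * u j z) y = coordCodivergence G u y := by
  have hdi (a b) := differentiableAt_of_contDiffOn hU (hG.contDiffOn_inv hU a b) hy
  have hpd (k : Fin 3) : pd k (fun z => ∑ j, (G z)⁻¹ k j * u j z) y =
      ∑ j, (pd k (fun z => (G z)⁻¹ k j) y * u j y + (G y)⁻¹ k j * pd k (u j) y) := by
    rw [pd_sum _ _ fun j _ => (hdi k j).fun_mul (hu j)]
    exact Finset.sum_congr rfl fun j _ => pd_mul k (hdi k j) (hu j)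
  have hΓ := hG.christoffel_symm hU hy
  have hinv := hG.inv_symm hy
  simp only [coordDivergence, coordCodivergence, hpd, hG.pd_inv_eq_christoffel hU hy]
  simp only [Fin.sum_univ_three, hΓ _ 1 0, hΓ _ 2 0, hΓ _ 2 1, hinv 1 0, hinv 2 0, hinv 2 1]
  ring

theorem sum_inv_mul_ricciVariation_eq_coordDivergence_sub (hG : IsMetricOn U G) (hU : IsOpen U)
    (hy : y ∈ U) {T : Fin 3 → Fin 3 → Fin 3 → E3 → ℝ} (hT : ∀ k i j, DifferentiableAt ℝ (T k i j) y)
    (hsymm : ∀ k i j, T k i j y = T k j i y) :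
    ∑ i, ∑ j, (G y)⁻¹ i j * ricciVariation G T i j y =
      coordDivergence G (fun k z => ∑ i, ∑ j, (G z)⁻¹ i j * T k i j z) y -
        coordCodivergence G (fun i z => ∑ k, T k i k z) y := by
  have hdi (a b) := differentiableAt_of_contDiffOn hU (hG.contDiffOn_inv hU a b) hy
  have hdiv (k : Fin 3) : pd k (fun z => ∑ i, ∑ j, (G z)⁻¹ i j * T k i j z) y =
      ∑ i, ∑ j, (pd k (fun z => (G z)⁻¹ i j) y * T k i j y + (G y)⁻¹ i j * pd k (T k i j) y) := by
    rw [pd_sum _ _ fun i _ => DifferentiableAt.fun_sum fun j _ => (hdi i j).fun_mul (hT k i j)]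
    refine Finset.sum_congr rfl fun i _ => ?_
    rw [pd_sum _ _ fun j _ => (hdi i j).fun_mul (hT k i j)]
    exact Finset.sum_congr rfl fun j _ => pd_mul k (hdi i j) (hT k i j)
  have htrace (i j : Fin 3) : pd i (fun z => ∑ k, T k j k z) y = ∑ k, pd i (T k j k) y :=
    pd_sum _ _ fun k _ => hT k j k
  have hΓ := hG.christoffel_symm hU hy
  have hinv := hG.inv_symm hy
  simp only [ricciVariation, coordDivergence, coordCodivergence, hdiv, htrace,
    hG.pd_inv_eq_christoffel hU hy]
  simp only [Fin.sum_univ_three, hΓ _ 1 0, hΓ _ 2 0, hΓ _ 2 1, hinv 1 0, hinv 2 0,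
    hinv 2 1, hsymm _ 1 0, hsymm _ 2 0, hsymm _ 2 1]
  ring

end IsMetricOn

/-- A family of coordinate metrics on `U`, smooth in the parameter `ε ∈ I` and the point
together. -/
structure IsMetricFamilyOn (I : Set ℝ) (U : Set E3) (A : ℝ → E3 → Mat3) : Prop where
  symm : ∀ ε ∈ I, ∀ z ∈ U, (A ε z).IsSymm
  det_ne_zero : ∀ ε ∈ I, ∀ z ∈ U, (A ε z).det ≠ 0
  jointlySmoothOn : ∀ i j, JointlySmoothOn I U fun ε z => A ε z i j

/-- The first-order change of the Levi-Civita connection of `G` when `G` is replaced by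
`(1 + η) • G`. -/
def conformalChristoffelVariation (G : E3 → Mat3) (η : E3 → ℝ) (k i j : Fin 3) (y : E3) : ℝ :=
  (1 / 2) * ((1 : Mat3) k j * pd i η y + (1 : Mat3) k i * pd j η y -
    G y i j * ∑ l, (G y)⁻¹ k l * pd l η y)

theorem conformalChristoffelVariation_symm {G : E3 → Mat3} {η : E3 → ℝ} {y : E3}
    (hG : (G y).IsSymm) (k i j : Fin 3) :
    conformalChristoffelVariation G η k i j y = conformalChristoffelVariation G η k j i y := by
  simp only [conformalChristoffelVariation, hG.apply i j]
  ring

theorem sum_inv_mul_conformalChristoffelVariation {G : E3 → Mat3} {y : E3} (hG : (G y).IsSymm)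
    (hdet : (G y).det ≠ 0) (η : E3 → ℝ) (k : Fin 3) :
    ∑ i, ∑ j, (G y)⁻¹ i j * conformalChristoffelVariation G η k i j y =
      ∑ l, (G y)⁻¹ k l * (-(1 / 2) * pd l η y) := by
  have htrace : ∑ i, ∑ j, (G y)⁻¹ i j * G y i j = 3 := by
    have h := congrArg Matrix.trace (Matrix.nonsing_inv_mul (G y) hdet.isUnit)
    simpa [Matrix.trace, Matrix.mul_apply, hG.apply] using h
  have hinv (i j : Fin 3) : (G y)⁻¹ i j = (G y)⁻¹ j i := by
    have h := Matrix.transpose_nonsing_inv (G y)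
    rw [hG] at h
    exact congrFun₂ h j i
  have hsplit (i j : Fin 3) : (G y)⁻¹ i j * conformalChristoffelVariation G η k i j y =
      (1 : Mat3) k j * ((G y)⁻¹ i j * (1 / 2 * pd i η y)) +
        (1 : Mat3) k i * ((G y)⁻¹ i j * (1 / 2 * pd j η y)) +
        (G y)⁻¹ i j * G y i j * ∑ l, (G y)⁻¹ k l * (-(1 / 2) * pd l η y) := by
    simp only [conformalChristoffelVariation, mul_left_comm _ (-(1 / 2) : ℝ), ← Finset.mul_sum]
    ring
  have hdelta (F : Fin 3 → ℝ) : ∑ i, (1 : Mat3) k i * F i = F k := by simp [Matrix.one_apply]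
  simp only [hsplit, Finset.sum_add_distrib, ← Finset.sum_mul, htrace, hdelta, ← Finset.mul_sum,
    hinv _ k]
  simp only [Finset.mul_sum, ← Finset.sum_add_distrib]
  exact Finset.sum_congr rfl fun l _ => by ring

theorem sum_conformalChristoffelVariation {G : E3 → Mat3} {y : E3} (hdet : (G y).det ≠ 0)
    (η : E3 → ℝ) (i : Fin 3) :
    ∑ k, conformalChristoffelVariation G η k i k y = 3 / 2 * pd i η y := by
  have hinv : ∑ k, G y i k * ∑ l, (G y)⁻¹ k l * pd l η y = pd i η y := by
    have h := congrFun (Matrix.mulVec_mulVec (fun l => pd l η y) (G y) (G y)⁻¹) i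
    rwa [Matrix.mul_nonsing_inv _ hdet.isUnit, Matrix.one_mulVec] at h
  simp only [conformalChristoffelVariation, ← Finset.mul_sum, Finset.sum_add_distrib,
    Finset.sum_sub_distrib, hinv]
  simp only [Matrix.one_apply_eq, Matrix.one_apply, ite_mul, one_mul, zero_mul, Finset.sum_ite_eq',
    Finset.mem_univ, if_true, Finset.sum_const, Finset.card_univ, Fintype.card_fin, nsmul_eq_mul]
  push_cast
  ring

theorem coordLaplacian_eq_coordCodivergence (G : E3 → Mat3) (η : E3 → ℝ) (y : E3) :
    coordLaplacian G η y = coordCodivergence G (fun j => pd j η) y :=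
  rfl

theorem coordCodivergence_const_mul (G : E3 → Mat3) (a : ℝ) (u : Fin 3 → E3 → ℝ) (y : E3) :
    coordCodivergence G (fun j z => a * u j z) y = a * coordCodivergence G u y := by
  simp only [coordCodivergence, pd_const_mul, Finset.mul_sum, mul_sub]
  simp only [mul_left_comm a]

theorem coordLaplacian_const_mul (G : E3 → Mat3) (a : ℝ) (u : E3 → ℝ) (y : E3) :
    coordLaplacian G (fun z => a * u z) y = a * coordLaplacian G u y := by
  simp only [coordLaplacian_eq_coordCodivergence, ← coordCodivergence_const_mul, ← pd_const_mul]

namespace IsMetricOn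

variable {U : Set E3} {G : E3 → Mat3} {η : E3 → ℝ} {y : E3}

theorem contDiffOn_conformalChristoffelVariation (hG : IsMetricOn U G) (hU : IsOpen U)
    (hη : ContDiffOn ℝ ∞ η U) (k i j : Fin 3) :
    ContDiffOn ℝ ∞ (conformalChristoffelVariation G η k i j) U :=
  contDiffOn_const.mul (((contDiffOn_const.mul (contDiffOn_pd i hU hη)).add
    (contDiffOn_const.mul (contDiffOn_pd j hU hη))).sub ((hG.contDiffOn i j).mul
      (ContDiffOn.sum fun l _ => (hG.contDiffOn_inv hU k l).mul (contDiffOn_pd l hU hη))))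

theorem sum_inv_mul_ricciVariation_conformal (hG : IsMetricOn U G) (hU : IsOpen U) (hy : y ∈ U)
    (hη : ContDiffOn ℝ ∞ η U) :
    ∑ i, ∑ j, (G y)⁻¹ i j * ricciVariation G (conformalChristoffelVariation G η) i j y =
      -2 * coordLaplacian G η y := by
  have hdη (j) : DifferentiableAt ℝ (pd j η) y :=
    differentiableAt_of_contDiffOn hU (contDiffOn_pd j hU hη) hy
  have hdT (k i j) := differentiableAt_of_contDiffOn hU
    (hG.contDiffOn_conformalChristoffelVariation hU hη k i j) hy
  have hdiv : coordDivergence G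
      (fun k z => ∑ i, ∑ j, (G z)⁻¹ i j * conformalChristoffelVariation G η k i j z) y =
      -(1 / 2) * coordLaplacian G η y := by
    rw [coordLaplacian_eq_coordCodivergence, ← coordCodivergence_const_mul,
      ← hG.coordDivergence_raise hU hy fun j => (hdη j).const_mul _]
    have htrace (k : Fin 3) := fun z hz => sum_inv_mul_conformalChristoffelVariation
      (hG.symm z hz) (hG.det_ne_zero z hz) η k
    refine Finset.sum_congr rfl fun k _ => ?_
    simp only [pd_congr_of_isOpen k hU hy (htrace k), htrace k y hy]
  have hcodiv : coordCodivergence G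
      (fun i z => ∑ k, conformalChristoffelVariation G η k i k z) y =
      3 / 2 * coordLaplacian G η y := by
    rw [coordLaplacian_eq_coordCodivergence, ← coordCodivergence_const_mul]
    have htrace (i : Fin 3) := fun z hz =>
      sum_conformalChristoffelVariation (hG.det_ne_zero z hz) η i
    refine Finset.sum_congr rfl fun i _ => Finset.sum_congr rfl fun j _ => ?_
    simp only [pd_congr_of_isOpen i hU hy (htrace j), htrace _ y hy]
  rw [hG.sum_inv_mul_ricciVariation_eq_coordDivergence_sub hU hy hdT
    fun k i j => conformalChristoffelVariation_symm (hG.symm y hy) k i j, hdiv, hcodiv]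
  ring

end IsMetricOn

namespace IsMetricFamilyOn

variable {I : Set ℝ} {U : Set E3} {A : ℝ → E3 → Mat3} {ε : ℝ}

theorem isMetricOn (hA : IsMetricFamilyOn I U A) (hε : ε ∈ I) : IsMetricOn U (A ε) where
  symm := hA.symm ε hε
  det_ne_zero := hA.det_ne_zero ε hε
  contDiffOn i j := (hA.jointlySmoothOn i j).contDiffOn hε

theorem jointlySmoothOn_inv (hA : IsMetricFamilyOn I U A) (hI : IsOpen I) (hU : IsOpen U)
    (i j : Fin 3) : JointlySmoothOn I U fun ε z => (A ε z)⁻¹ i j :=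
  contDiffOn_matrix_inv (hI.prod hU) hA.jointlySmoothOn
    (fun p hp => hA.det_ne_zero p.1 hp.1 p.2 hp.2) i j

theorem jointlySmoothOn_christoffel (hA : IsMetricFamilyOn I U A) (hI : IsOpen I)
    (hU : IsOpen U) (k i j : Fin 3) :
    JointlySmoothOn I U fun ε z => christoffel (A ε) k i j z := by
  have hpd (l a b : Fin 3) : JointlySmoothOn I U fun ε => pd l fun z => A ε z a b :=
    (hA.jointlySmoothOn a b).fderiv_apply hI hU _
  exact contDiffOn_const.mul (ContDiffOn.sum fun l _ =>
    (hA.jointlySmoothOn_inv hI hU k l).mul (((hpd i j l).add (hpd j i l)).sub (hpd l i j)))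

end IsMetricFamilyOn

section CurvatureVariation

variable {n : ℕ} [NeZero n] {I : Set ℝ} {U : Set E3} {A₁ A₂ : ℝ → E3 → Mat3} {η : E3 → ℝ}
  {y : E3}

theorem hasVariation_inv_conformal (h₁ : IsMetricFamilyOn I U A₁) (h0 : 0 ∈ I)
    (h : ∀ z ∈ U, ∀ i j, HasVariation n (A₁ · z i j) (A₂ · z i j) (η z * A₁ 0 z i j))
    (hy : y ∈ U) (i j : Fin 3) :
    HasVariation n (fun ε => (A₁ ε y)⁻¹ i j) (fun ε => (A₂ ε y)⁻¹ i j)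
      (-(η y * (A₁ 0 y)⁻¹ i j)) := by
  have hdet := h₁.det_ne_zero 0 h0 y hy
  refine (HasVariation.matrix_inv (D := η y • A₁ 0 y) (h y hy) hdet i j).congr_variation ?_
  rw [Matrix.mul_smul, Matrix.smul_mul, Matrix.nonsing_inv_mul _ hdet.isUnit, Matrix.one_mul]
  rfl

theorem hasVariation_christoffel_conformal (hI : IsOpen I) (h0 : 0 ∈ I) (hU : IsOpen U)
    (h₁ : IsMetricFamilyOn I U A₁) (h₂ : IsMetricFamilyOn I U A₂) (hη : ContDiffOn ℝ ∞ η U)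
    (h : ∀ z ∈ U, ∀ i j, HasVariation n (A₁ · z i j) (A₂ · z i j) (η z * A₁ 0 z i j))
    (hy : y ∈ U) (k i j : Fin 3) :
    HasVariation n (fun ε => christoffel (A₁ ε) k i j y) (fun ε => christoffel (A₂ ε) k i j y)
      (conformalChristoffelVariation (A₁ 0) η k i j y) := by
  have hG := h₁.isMetricOn h0
  have hdη := differentiableAt_of_contDiffOn hU hη hy
  have hdG (a b) := differentiableAt_of_contDiffOn hU (hG.contDiffOn a b) hy
  have hpd (l a b : Fin 3) : HasVariation n (fun ε => pd l (fun z => A₁ ε z a b) y)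
      (fun ε => pd l (fun z => A₂ ε z a b) y)
      (pd l η y * A₁ 0 y a b + η y * pd l (fun z => A₁ 0 z a b) y) :=
    (HasVariation.fderiv_apply (fun z hz => h z hz a b) hI h0 hU (h₁.jointlySmoothOn a b)
      (h₂.jointlySmoothOn a b) hy _).congr_variation (pd_mul l hdη (hdG a b))
  have hinv (a b) := hasVariation_inv_conformal h₁ h0 h hy a b
  refine ((HasVariation.sum fun l _ => (hinv k l).mul
    (((hpd i j l).add (hpd j i l)).sub (hpd l i j))).const_mul (1 / 2)).congr_variation ?_
  have hone (a : Fin 3) : (1 : Mat3) k a = ∑ l, (A₁ 0 y)⁻¹ k l * A₁ 0 y a l := by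
    rw [← Matrix.nonsing_inv_mul _ (hG.det_ne_zero y hy).isUnit, Matrix.mul_apply]
    simp only [(hG.symm y hy).apply a]
  rw [conformalChristoffelVariation, hone j, hone i]
  simp only [Finset.sum_mul, Finset.mul_sum, ← Finset.sum_add_distrib, ← Finset.sum_sub_distrib]
  exact Finset.sum_congr rfl fun l _ => by ring

theorem hasVariation_coordScalarCurvature_conformal (hI : IsOpen I) (h0 : 0 ∈ I) (hU : IsOpen U)
    (h₁ : IsMetricFamilyOn I U A₁) (h₂ : IsMetricFamilyOn I U A₂) (hη : ContDiffOn ℝ ∞ η U)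
    (h : ∀ z ∈ U, ∀ i j, HasVariation n (A₁ · z i j) (A₂ · z i j) (η z * A₁ 0 z i j))
    (hy : y ∈ U) :
    HasVariation n (fun ε => coordScalarCurvature (A₁ ε) y)
      (fun ε => coordScalarCurvature (A₂ ε) y)
      (-η y * coordScalarCurvature (A₁ 0) y - 2 * coordLaplacian (A₁ 0) η y) := by
  have hG := h₁.isMetricOn h0
  have hΓ (k i j) {z} (hz : z ∈ U) :=
    hasVariation_christoffel_conformal hI h0 hU h₁ h₂ hη h hz k i j
  have hpd (l k i j : Fin 3) : HasVariation n (fun ε => pd l (christoffel (A₁ ε) k i j) y)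
      (fun ε => pd l (christoffel (A₂ ε) k i j) y)
      (pd l (conformalChristoffelVariation (A₁ 0) η k i j) y) :=
    HasVariation.fderiv_apply (fun z hz => hΓ k i j hz) hI h0 hU
      (h₁.jointlySmoothOn_christoffel hI hU k i j) (h₂.jointlySmoothOn_christoffel hI hU k i j)
      hy _
  have hricci (i j : Fin 3) :=
    (HasVariation.sum (s := Finset.univ) fun k _ => (hpd k k i j).sub (hpd j k i k)).add
      (HasVariation.sum (s := Finset.univ) fun k _ => HasVariation.sum (s := Finset.univ) fun l _ =>
        ((hΓ k i j hy).mul (hΓ l k l hy)).sub ((hΓ k i l hy).mul (hΓ l j k hy)))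
  refine (HasVariation.sum fun i _ => HasVariation.sum fun j _ =>
    (hasVariation_inv_conformal h₁ h0 h hy i j).mul (hricci i j)).congr_variation ?_
  have hpalatini := hG.sum_inv_mul_ricciVariation_conformal hU hy hη
  simp only [ricciVariation] at hpalatini
  rw [sub_eq_add_neg, ← neg_mul, ← hpalatini, coordScalarCurvature]
  simp only [Finset.mul_sum, ← Finset.sum_add_distrib]
  simp only [mul_assoc, neg_mul]

end CurvatureVariation

section ParametricIntegrals

variable {E : Type*} {I : Set ℝ} {K : Set E} {A : ℝ → E → ℝ} {ε : ℝ}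

theorem iteratedDeriv_eq_zero_of_notMem (hI : IsOpen I) (hz : ∀ e ∈ I, ∀ z ∉ K, A e z = 0)
    (k : ℕ) (hε : ε ∈ I) {z : E} (hzK : z ∉ K) : iteratedDeriv k (fun e => A e z) ε = 0 := by
  have h : (fun e => A e z) =ᶠ[𝓝 ε] fun _ => 0 := by
    filter_upwards [hI.mem_nhds hε] with e he using hz e he z hzK
  rw [h.iteratedDeriv_eq, iteratedDeriv_const]
  simp

variable [NormedAddCommGroup E] [NormedSpace ℝ E]

namespace JointlySmoothOn

theorem continuous (hA : JointlySmoothOn I Set.univ A) (hε : ε ∈ I) : Continuous (A ε) :=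
  continuousOn_univ.1 (hA.contDiffOn hε).continuousOn

theorem hasDerivAt_param {U : Set E} {y : E} (hA : JointlySmoothOn I U A) (hI : IsOpen I)
    (hε : ε ∈ I) (hy : y ∈ U) :
    HasDerivAt (fun e => A e y) (deriv (fun e => A e y) ε) ε :=
  ((hA.contDiffAt_param hI hε hy).differentiableAt (by simp)).hasDerivAt

variable [MeasurableSpace E] [BorelSpace E] {μ : Measure E} [IsFiniteMeasureOnCompacts μ]

theorem integrable (hA : JointlySmoothOn I Set.univ A) (hK : IsCompact K)
    (hz : ∀ e ∈ I, ∀ z ∉ K, A e z = 0) (hε : ε ∈ I) : Integrable (A ε) μ :=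
  (hA.continuous hε).integrable_of_hasCompactSupport (.intro hK (hz ε hε))

variable [SecondCountableTopologyEither E ℝ]

theorem hasDerivAt_integral (hA : JointlySmoothOn I Set.univ A) (hI : IsOpen I)
    (hK : IsCompact K) (hz : ∀ e ∈ I, ∀ z ∉ K, A e z = 0) (hε : ε ∈ I) :
    HasDerivAt (fun e => ∫ z, A e z ∂μ) (∫ z, deriv (fun e => A e z) ε ∂μ) ε := by
  have hdA := hA.deriv_param hI isOpen_univ
  obtain ⟨r, hr, hrI⟩ := Metric.nhds_basis_closedBall.mem_iff.1 (hI.mem_nhds hε)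
  obtain ⟨C, hC⟩ := ((isCompact_closedBall ε r).prod hK).exists_bound_of_continuousOn
    (hdA.continuousOn.mono (Set.prod_mono hrI (Set.subset_univ K)))
  refine (hasDerivAt_integral_of_dominated_loc_of_deriv_le (bound := K.indicator fun _ => C)
    (F' := fun e z => deriv (fun e => A e z) e) (Metric.closedBall_mem_nhds ε hr) ?_
    (hA.integrable hK hz hε) (hdA.continuous hε).aestronglyMeasurable
    (.of_forall fun z e he => ?_) ?_
    (.of_forall fun z e he => hA.hasDerivAt_param hI (hrI he) (Set.mem_univ z))).2
  · filter_upwards [hI.mem_nhds hε] with e he using (hA.continuous he).aestronglyMeasurable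
  · by_cases hzK : z ∈ K
    · rw [Set.indicator_of_mem hzK]
      exact hC (e, z) ⟨he, hzK⟩
    · rw [Set.indicator_of_notMem hzK, ← iteratedDeriv_one,
        iteratedDeriv_eq_zero_of_notMem hI hz 1 (hrI he) hzK, norm_zero]
  · exact (integrable_indicator_iff hK.measurableSet).2
      (integrableOn_const hK.measure_lt_top.ne)

theorem iteratedDeriv_integral (hA : JointlySmoothOn I Set.univ A) (hI : IsOpen I)
    (hK : IsCompact K) (hz : ∀ e ∈ I, ∀ z ∉ K, A e z = 0) (k : ℕ) (hε : ε ∈ I) :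
    iteratedDeriv k (fun e => ∫ z, A e z ∂μ) ε = ∫ z, iteratedDeriv k (fun e => A e z) ε ∂μ := by
  induction k generalizing ε with
  | zero => simp
  | succ k ih =>
    have hk : iteratedDeriv k (fun e => ∫ z, A e z ∂μ) =ᶠ[𝓝 ε]
        fun e => ∫ z, iteratedDeriv k (fun e => A e z) e ∂μ := by
      filter_upwards [hI.mem_nhds hε] with e he using ih he
    simp only [iteratedDeriv_succ]
    rw [hk.deriv_eq]
    exact ((hA.iteratedDeriv_param hI isOpen_univ k).hasDerivAt_integral hI hK
      (fun e he z => iteratedDeriv_eq_zero_of_notMem hI hz k he) hε).deriv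

theorem contDiffAt_integral (hA : JointlySmoothOn I Set.univ A) (hI : IsOpen I)
    (hK : IsCompact K) (hz : ∀ e ∈ I, ∀ z ∉ K, A e z = 0) (hε : ε ∈ I) :
    ContDiffAt ℝ ∞ (fun e => ∫ z, A e z ∂μ) ε := by
  refine (contDiffOn_of_differentiableOn_deriv fun m _ e he => ?_).contDiffAt (hI.mem_nhds hε)
  have h : DifferentiableAt ℝ (fun e => ∫ z, iteratedDeriv m (fun e => A e z) e ∂μ) e :=
    ((hA.iteratedDeriv_param hI isOpen_univ m).hasDerivAt_integral hI hK
      (fun e he z => iteratedDeriv_eq_zero_of_notMem hI hz m he) he).differentiableAt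
  have h_eq : ∀ e ∈ I, iteratedDerivWithin m (fun e => ∫ z, A e z ∂μ) I e =
      ∫ z, iteratedDeriv m (fun e => A e z) e ∂μ := fun e he => by
    rw [iteratedDerivWithin_of_isOpen hI he, hA.iteratedDeriv_integral hI hK hz m he]
  exact h.differentiableWithinAt.congr h_eq (h_eq e he)

theorem epsCoeff_integral (hA : JointlySmoothOn I Set.univ A) (hI : IsOpen I) (h0 : 0 ∈ I)
    (hK : IsCompact K) (hz : ∀ e ∈ I, ∀ z ∉ K, A e z = 0) (k : ℕ) :
    epsCoeff k (fun e => ∫ z, A e z ∂μ) = ∫ z, epsCoeff k (fun e => A e z) ∂μ := by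
  simp only [epsCoeff, hA.iteratedDeriv_integral hI hK hz k h0, integral_div]

end JointlySmoothOn

theorem HasVariation.integral [MeasurableSpace E] [BorelSpace E]
    [SecondCountableTopologyEither E ℝ] {μ : Measure E} [IsFiniteMeasureOnCompacts μ] {n : ℕ}
    {A₁ A₂ : ℝ → E → ℝ} {d : E → ℝ} (h : ∀ z, HasVariation n (A₁ · z) (A₂ · z) (d z))
    (hI : IsOpen I) (h0 : 0 ∈ I) (hK : IsCompact K) (h₁ : JointlySmoothOn I Set.univ A₁)
    (h₂ : JointlySmoothOn I Set.univ A₂) (hz₁ : ∀ e ∈ I, ∀ z ∉ K, A₁ e z = 0)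
    (hz₂ : ∀ e ∈ I, ∀ z ∉ K, A₂ e z = 0) :
    HasVariation n (fun ε => ∫ z, A₁ ε z ∂μ) (fun ε => ∫ z, A₂ ε z ∂μ) (∫ z, d z ∂μ) := by
  have integrable_epsCoeff : ∀ {A : ℝ → E → ℝ}, JointlySmoothOn I Set.univ A →
      (∀ e ∈ I, ∀ z ∉ K, A e z = 0) → Integrable (fun z => epsCoeff n (A · z)) μ :=
    fun hA hz => ((hA.iteratedDeriv_param hI isOpen_univ n).integrable hK
      (fun e he z => iteratedDeriv_eq_zero_of_notMem hI hz n he) h0).div_const _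
  have h_coeff := fun z => (hasVariation_iff.1 (h z)).2.2
  refine hasVariation_iff.2 ⟨h₁.contDiffAt_integral hI hK hz₁ h0,
    h₂.contDiffAt_integral hI hK hz₂ h0, fun k hk => ?_, ?_⟩
  · rw [h₁.epsCoeff_integral hI h0 hK hz₁, h₂.epsCoeff_integral hI h0 hK hz₂]
    exact integral_congr_ae (.of_forall fun z => (h_coeff z).1 k hk)
  · rw [h₁.epsCoeff_integral hI h0 hK hz₁, h₂.epsCoeff_integral hI h0 hK hz₂,
      ← integral_sub (integrable_epsCoeff h₁ hz₁) (integrable_epsCoeff h₂ hz₂)]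
    exact integral_congr_ae (.of_forall fun z => (h_coeff z).2)

end ParametricIntegrals

/-! ### Tensor fields and integration on the manifold -/

section Charts

variable {M : Type*} [TopologicalSpace M] [ChartedSpace E3 M] [IsManifold (𝓡 3) ∞ M]

theorem jac_eq_toMatrix (c x : M) :
    jac c x = LinearMap.toMatrix (EuclideanSpace.basisFun (Fin 3) ℝ).toBasis
      (EuclideanSpace.basisFun (Fin 3) ℝ).toBasis
      (tangentCoordChange (𝓡 3) c x x : E3 →ₗ[ℝ] E3) := by
  ext i j
  simp [jac, LinearMap.toMatrix_apply]

theorem det_jac_ne_zero {c x : M} (hx : x ∈ (extChartAt (𝓡 3) c).source) :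
    (jac c x).det ≠ 0 := by
  have h_inv : (tangentCoordChange (𝓡 3) x c x : E3 →ₗ[ℝ] E3) ∘ₗ
      (tangentCoordChange (𝓡 3) c x x : E3 →ₗ[ℝ] E3) = .id := by
    ext1 v
    exact (tangentCoordChange_comp ⟨⟨hx, mem_extChartAt_source x⟩, hx⟩).trans
      (tangentCoordChange_self hx)
  have h_mul := congrArg (LinearMap.toMatrix (EuclideanSpace.basisFun (Fin 3) ℝ).toBasis
    (EuclideanSpace.basisFun (Fin 3) ℝ).toBasis) h_inv
  rw [LinearMap.toMatrix_comp _ (EuclideanSpace.basisFun (Fin 3) ℝ).toBasis, ← jac_eq_toMatrix,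
    LinearMap.toMatrix_id] at h_mul
  exact (Matrix.isUnit_det_of_left_inverse h_mul).ne_zero

theorem jac_self (x : M) : jac x x = 1 := by
  ext i j
  simp only [jac, Matrix.of_apply, tangentCoordChange_self (mem_extChartAt_source (I := 𝓡 3) x)]
  simp [Matrix.one_apply]

theorem covComp_self (g : M → Mat3) (x : M) : covComp x g (extChartAt (𝓡 3) x x) = g x := by
  simp [covComp, jac_self]

theorem densComp_self (π : M → Mat3) (x : M) : densComp x π (extChartAt (𝓡 3) x x) = π x := by
  simp [densComp, jac_self]

theorem covComp_isSymm (c : M) {g : M → Mat3} (hg : ∀ x, (g x).IsSymm) (y : E3) :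
    (covComp c g y).IsSymm := by
  simp only [covComp, Matrix.IsSymm, Matrix.transpose_mul, Matrix.transpose_transpose, (hg _).eq,
    Matrix.mul_assoc]

theorem det_covComp (c : M) (g : M → Mat3) (y : E3) :
    (covComp c g y).det = (jac c ((extChartAt (𝓡 3) c).symm y)).det ^ 2 *
      (g ((extChartAt (𝓡 3) c).symm y)).det := by
  simp only [covComp, Matrix.det_mul, Matrix.det_transpose]
  ring

theorem det_covComp_pos_iff {c : M} (g : M → Mat3) {y : E3}
    (hy : y ∈ (extChartAt (𝓡 3) c).target) :
    0 < (covComp c g y).det ↔ 0 < (g ((extChartAt (𝓡 3) c).symm y)).det := by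
  have hJ := det_jac_ne_zero ((extChartAt (𝓡 3) c).map_target hy)
  rw [det_covComp, mul_pos_iff_of_pos_left (by positivity)]

theorem covComp_smul (c : M) (u : M → ℝ) (g : M → Mat3) (y : E3) :
    covComp c (fun x => u x • g x) y = u ((extChartAt (𝓡 3) c).symm y) • covComp c g y := by
  simp only [covComp, Matrix.mul_smul, Matrix.smul_mul]

theorem scalarDensComp_sqrtDet (c : M) (g : M → Mat3) (y : E3) :
    scalarDensComp c (sqrtDet g) y = Real.sqrt (covComp c g y).det := by
  rw [det_covComp, Real.sqrt_mul (sq_nonneg _), Real.sqrt_sq_eq_abs]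
  rfl

theorem scalarDensComp_momTrace {c : M} (g π : M → Mat3) {y : E3}
    (hy : y ∈ (extChartAt (𝓡 3) c).target) :
    scalarDensComp c (momTrace g π) y =
      ∑ a, ∑ b, densComp c π y a b * covComp c g y a b := by
  have h_trace : ∀ P Q : Mat3, ∑ a, ∑ b, P a b * Q a b = (P * Q.transpose).trace :=
    fun P Q => Matrix.sum_hadamard_eq P Q
  simp only [scalarDensComp, momTrace, h_trace, densComp, covComp]
  set x := (extChartAt (𝓡 3) c).symm y
  set J := jac c x
  have hJ : IsUnit J.det := (det_jac_ne_zero ((extChartAt (𝓡 3) c).map_target hy)).isUnit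
  have hJt : J⁻¹.transpose * J.transpose = 1 := by
    rw [← Matrix.transpose_mul, Matrix.mul_nonsing_inv _ hJ, Matrix.transpose_one]
  rw [Matrix.smul_mul, Matrix.trace_smul, smul_eq_mul]
  congr 1
  calc (π x * (g x).transpose).trace
      = (J⁻¹ * (π x * (g x).transpose * J)).trace := by
        rw [Matrix.trace_mul_comm J⁻¹, Matrix.mul_assoc _ J, Matrix.mul_nonsing_inv _ hJ,
          Matrix.mul_one]
    _ = (J⁻¹ * π x * (J⁻¹.transpose * J.transpose) * (g x).transpose * J).trace := by
        rw [hJt]; simp only [Matrix.mul_assoc, Matrix.mul_one]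
    _ = (J⁻¹ * π x * J⁻¹.transpose * (J.transpose * g x * J).transpose).trace := by
        simp only [Matrix.transpose_mul, Matrix.transpose_transpose, Matrix.mul_assoc]

namespace IsRiemannianMetric

variable {g : M → Mat3}

theorem isSymm (hg : IsRiemannianMetric g) (x : M) : (g x).IsSymm := by
  obtain ⟨G, hG⟩ := hg
  ext i j
  rw [Matrix.transpose_apply, hG, hG]
  exact G.symm x _ _

theorem det_pos (hg : IsRiemannianMetric g) (x : M) : 0 < (g x).det := by
  have h_symm := hg.isSymm x
  obtain ⟨G, hG⟩ := hg
  refine Matrix.PosDef.det_pos (Matrix.PosDef.of_dotProduct_mulVec_pos ?_ fun v hv => ?_)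
  · rwa [Matrix.IsHermitian, Matrix.conjTranspose_eq_transpose_of_trivial]
  · let e : Fin 3 → TangentSpace (𝓡 3) x := fun i => (EuclideanSpace.single i 1 : E3)
    have h_ne : ∑ i, v i • e i ≠ 0 := fun h => hv <| funext fun j => by
      have h_sum : ∑ i, v i • (EuclideanSpace.single i 1 : E3) = 0 := h
      simpa [Pi.single_apply] using congrArg (fun w : E3 => w j) h_sum
    have h_inner : G.inner x (∑ i, v i • e i) (∑ i, v i • e i) = star v ⬝ᵥ (g x).mulVec v := by
      simp only [map_sum, map_smul, dotProduct, Matrix.mulVec, hG, star_trivial,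
        sum_apply, smul_apply, smul_eq_mul, Finset.mul_sum]
      rw [Finset.sum_comm]
      exact Finset.sum_congr rfl fun i _ => Finset.sum_congr rfl fun j _ => by ring
    exact h_inner ▸ G.pos x _ h_ne

end IsRiemannianMetric

section Integration

variable [T2Space M] [CompactSpace M]

theorem tsupport_chartPartition_subset_source (c : M) :
    tsupport (chartPartition M c) ⊆ (extChartAt (𝓡 3) c).source := by
  rw [extChartAt_source]
  exact (SmoothPartitionOfUnity.exists_isSubordinate_chartAt_source (𝓡 3) M).choose_spec c

/-- The image in the chart at `c` of the support of the corresponding partition function. -/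
def chartSupport (c : M) : Set E3 := extChartAt (𝓡 3) c '' tsupport (chartPartition M c)

theorem isCompact_chartSupport (c : M) : IsCompact (chartSupport c) :=
  (isClosed_tsupport _).isCompact.image_of_continuousOn
    ((continuousOn_extChartAt c).mono (tsupport_chartPartition_subset_source c))

theorem chartSupport_subset_target (c : M) : chartSupport c ⊆ (extChartAt (𝓡 3) c).target := by
  rintro _ ⟨x, hx, rfl⟩
  exact (extChartAt (𝓡 3) c).map_source (tsupport_chartPartition_subset_source c hx)

theorem chartPartition_symm_eq_zero {c : M} {y : E3} (hy : y ∈ (extChartAt (𝓡 3) c).target)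
    (hyK : y ∉ chartSupport c) : chartPartition M c ((extChartAt (𝓡 3) c).symm y) = 0 := by
  by_contra h
  exact hyK ⟨_, subset_tsupport _ h, (extChartAt (𝓡 3) c).right_inv hy⟩

theorem contDiffOn_chartPartition (c : M) :
    ContDiffOn ℝ ∞ (fun y => chartPartition M c ((extChartAt (𝓡 3) c).symm y))
      (extChartAt (𝓡 3) c).target :=
  contMDiffOn_iff_contDiffOn.1 <| (chartPartition M c).contMDiff.comp_contMDiffOn
    (contMDiffOn_extChartAt_symm (I := 𝓡 3) (n := ∞) c)

/-- The integrand of `densIntegral` in the chart at `c`, extended by zero. -/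
def chartIntegrand (c : M) (ρ : M → ℝ) : E3 → ℝ :=
  (extChartAt (𝓡 3) c).target.indicator
    fun y => chartPartition M c ((extChartAt (𝓡 3) c).symm y) * scalarDensComp c ρ y

theorem exists_finset_densIntegral_eq (M : Type*) [TopologicalSpace M] [ChartedSpace E3 M]
    [IsManifold (𝓡 3) ∞ M] [T2Space M] [CompactSpace M] :
    ∃ s : Finset M, (∀ c ∉ s, ∀ x, chartPartition M c x = 0) ∧
      ∀ ρ : M → ℝ, densIntegral ρ = ∑ c ∈ s, ∫ y, chartIntegrand c ρ y := by
  have hfin := (chartPartition M).locallyFinite.finite_nonempty_of_compact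
  have h_zero : ∀ c ∉ hfin.toFinset, ∀ x, chartPartition M c x = 0 := fun c hc => by
    simp only [Set.Finite.mem_toFinset, Set.mem_ofPred_eq, Set.not_nonempty_iff_eq_empty,
      Function.support_eq_empty_iff] at hc
    exact congrFun hc
  refine ⟨hfin.toFinset, h_zero, fun ρ => ?_⟩
  simp only [chartIntegrand, integral_indicator (isOpen_extChartAt_target _).measurableSet]
  exact finsum_eq_sum_of_support_subset _ fun c hc => by_contra fun h => hc <| by
    simp [h_zero c (by simpa using h)]

theorem chartIntegrand_eq_zero {c : M} (ρ : M → ℝ) {y : E3} (hy : y ∉ chartSupport c) :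
    chartIntegrand c ρ y = 0 :=
  Set.indicator_apply_eq_zero.2 fun ht => by rw [chartPartition_symm_eq_zero ht hy, zero_mul]

theorem jointlySmoothOn_chartIntegrand {I : Set ℝ} (hI : IsOpen I) {ρ : ℝ → M → ℝ} {c : M}
    (hρ : JointlySmoothOn I (extChartAt (𝓡 3) c).target fun ε => scalarDensComp c (ρ ε)) :
    JointlySmoothOn I Set.univ fun ε => chartIntegrand c (ρ ε) := by
  rintro ⟨e, y⟩ ⟨he, -⟩
  refine ContDiffAt.contDiffWithinAt ?_
  by_cases hy : y ∈ (extChartAt (𝓡 3) c).target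
  · have h_nhds := (hI.prod (isOpen_extChartAt_target c)).mem_nhds (show (e, y) ∈ _ from ⟨he, hy⟩)
    have h_smooth := ((contDiffOn_chartPartition c).comp contDiffOn_snd fun p hp => hp.2).mul hρ
    refine (h_smooth.contDiffAt h_nhds).congr_of_eventuallyEq ?_
    filter_upwards [h_nhds] with p hp using Set.indicator_of_mem hp.2 _
  · refine (contDiffAt_const (c := (0 : ℝ))).congr_of_eventuallyEq ?_
    filter_upwards [(hI.prod (isCompact_chartSupport c).isClosed.isOpen_compl).mem_nhds
      (show (e, y) ∈ _ from ⟨he, fun h => hy (chartSupport_subset_target c h)⟩)] with p hp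
    exact chartIntegrand_eq_zero _ hp.2

theorem HasVariation.densIntegral {n : ℕ} {I : Set ℝ} {ρ₁ ρ₂ : ℝ → M → ℝ} {σ : M → ℝ}
    (h : ∀ x, HasVariation n (ρ₁ · x) (ρ₂ · x) (σ x)) (hI : IsOpen I) (h0 : 0 ∈ I)
    (h₁ : ∀ c, JointlySmoothOn I (extChartAt (𝓡 3) c).target fun ε => scalarDensComp c (ρ₁ ε))
    (h₂ : ∀ c, JointlySmoothOn I (extChartAt (𝓡 3) c).target fun ε => scalarDensComp c (ρ₂ ε)) :
    HasVariation n (fun ε => densIntegral (ρ₁ ε)) (fun ε => densIntegral (ρ₂ ε))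
      (densIntegral σ) := by
  obtain ⟨s, -, hs⟩ := exists_finset_densIntegral_eq M
  simp only [hs]
  refine HasVariation.sum fun c _ => HasVariation.integral (A₁ := fun ε => chartIntegrand c (ρ₁ ε))
    (A₂ := fun ε => chartIntegrand c (ρ₂ ε)) (fun y => ?_) hI h0 (isCompact_chartSupport c)
    (jointlySmoothOn_chartIntegrand hI (h₁ c)) (jointlySmoothOn_chartIntegrand hI (h₂ c))
    (fun e _ z hz => chartIntegrand_eq_zero _ hz) (fun e _ z hz => chartIntegrand_eq_zero _ hz)
  by_cases hy : y ∈ (extChartAt (𝓡 3) c).target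
  · simpa only [chartIntegrand, Set.indicator_of_mem hy, scalarDensComp] using
      ((h _).const_mul _).const_mul _
  · simpa only [chartIntegrand, Set.indicator_of_notMem hy] using .refl contDiffAt_const

theorem densIntegral_zero : densIntegral (0 : M → ℝ) = 0 := by
  simp [densIntegral, scalarDensComp]

theorem densIntegral_pos [Nonempty M] {ρ : M → ℝ} (hpos : ∀ x, 0 < ρ x)
    (hρ : ∀ c, ContDiffOn ℝ ∞ (scalarDensComp c ρ) (extChartAt (𝓡 3) c).target) :
    0 < densIntegral ρ := by
  obtain ⟨s, hs0, hs⟩ := exists_finset_densIntegral_eq M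
  rw [hs]
  have h_nonneg : ∀ c y, 0 ≤ chartIntegrand c ρ y := fun c y =>
    Set.indicator_nonneg (fun z _ => mul_nonneg ((chartPartition M).nonneg c _)
      (mul_nonneg (abs_nonneg _) (hpos _).le)) y
  obtain ⟨x⟩ := ‹Nonempty M›
  obtain ⟨c, hc⟩ := (chartPartition M).exists_pos_of_mem (Set.mem_univ x)
  have hcs : c ∈ s := by_contra fun h => hc.ne' (hs0 c h x)
  refine Finset.sum_pos' (fun c _ => integral_nonneg (h_nonneg c)) ⟨c, hcs, ?_⟩
  have hxs : x ∈ (extChartAt (𝓡 3) c).source :=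
    tsupport_chartPartition_subset_source c (subset_tsupport _ hc.ne')
  have h_cont : Continuous (chartIntegrand c ρ) :=
    (jointlySmoothOn_chartIntegrand (ρ := fun _ => ρ) isOpen_univ
      ((hρ c).comp contDiffOn_snd fun p hp => hp.2)).continuous (Set.mem_univ 0)
  refine h_cont.integral_pos_of_hasCompactSupport_nonneg_nonzero
    (.intro (isCompact_chartSupport c) fun y hy => chartIntegrand_eq_zero _ hy)
    (h_nonneg c) (x := extChartAt (𝓡 3) c x) ?_
  rw [chartIntegrand, Set.indicator_of_mem ((extChartAt (𝓡 3) c).map_source hxs),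
    scalarDensComp, (extChartAt (𝓡 3) c).left_inv hxs]
  exact mul_ne_zero hc.ne' (mul_ne_zero (abs_ne_zero.2 (det_jac_ne_zero hxs)) (hpos x).ne')

end Integration

end Charts

/-! ### The transformed constraint -/

section MomentumAlgebra

variable {M : Type*} (g π : M → Mat3) (x : M)

theorem momTrace_eq_trace : momTrace g π x = (π x * (g x).transpose).trace :=
  Matrix.sum_hadamard_eq (π x) (g x)

theorem momSq_eq_trace :
    momSq g π x = ((π x).transpose * g x * π x * (g x).transpose).trace := by
  simp only [momSq, Matrix.trace, Matrix.diag, Matrix.mul_apply, Matrix.transpose_apply,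
    Fin.sum_univ_three]
  ring

theorem momTrace_smul_smul (u v : M → ℝ) :
    momTrace (fun z => u z • g z) (fun z => v z • π z) x = u x * v x * momTrace g π x := by
  simp only [momTrace_eq_trace, Matrix.transpose_smul, Matrix.smul_mul, Matrix.mul_smul,
    Matrix.trace_smul, smul_eq_mul, mul_assoc]

theorem momSq_smul_smul (u v : M → ℝ) :
    momSq (fun z => u z • g z) (fun z => v z • π z) x = (u x * v x) ^ 2 * momSq g π x := by
  simp only [momSq_eq_trace, Matrix.transpose_smul, Matrix.smul_mul, Matrix.mul_smul,
    Matrix.trace_smul, smul_eq_mul]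
  ring

variable {g x}

theorem momTrace_sub_smul_inv (hsymm : (g x).IsSymm) (hdet : (g x).det ≠ 0) (s : M → ℝ) :
    momTrace g (fun z => π z - s z • (g z)⁻¹) x = momTrace g π x - 3 * s x := by
  simp only [momTrace_eq_trace, hsymm.eq, Matrix.sub_mul, Matrix.smul_mul,
    Matrix.nonsing_inv_mul _ hdet.isUnit, Matrix.trace_sub, Matrix.trace_smul, Matrix.trace_one,
    Fintype.card_fin, smul_eq_mul]
  push_cast
  ring

theorem momSq_sub_smul_inv (hsymm : (g x).IsSymm) (hdet : (g x).det ≠ 0) (s : M → ℝ) :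
    momSq g (fun z => π z - s z • (g z)⁻¹) x =
      momSq g π x - 2 * s x * momTrace g π x + 3 * s x ^ 2 := by
  have h_inv : (g x)⁻¹ * g x = 1 := Matrix.nonsing_inv_mul _ hdet.isUnit
  have h_inv_symm : (g x)⁻¹.transpose = (g x)⁻¹ := by
    rw [Matrix.transpose_nonsing_inv, hsymm.eq]
  have h_trace : ((π x).transpose * g x).trace = (π x * g x).trace := by
    rw [← Matrix.trace_transpose, Matrix.transpose_mul, Matrix.transpose_transpose, hsymm.eq,
      Matrix.trace_mul_comm]
  have h_expand : ((π x - s x • (g x)⁻¹).transpose * g x * (π x - s x • (g x)⁻¹) * g x) =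
      (π x).transpose * g x * π x * g x - s x • ((π x).transpose * g x) - s x • (π x * g x)
        + s x ^ 2 • 1 := by
    simp only [Matrix.transpose_sub, Matrix.transpose_smul, h_inv_symm, Matrix.sub_mul,
      Matrix.mul_sub, Matrix.smul_mul, Matrix.mul_smul, h_inv, Matrix.one_mul,
      Matrix.mul_assoc _ (g x)⁻¹ (g x), Matrix.mul_one, smul_sub, smul_smul, sq]
    abel
  simp only [momSq_eq_trace, momTrace_eq_trace, hsymm.eq, h_expand, Matrix.trace_add,
    Matrix.trace_sub, Matrix.trace_smul, h_trace, Matrix.trace_one, Fintype.card_fin, smul_eq_mul]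
  push_cast
  ring

end MomentumAlgebra

theorem exp_four_mul_eq_rpow (t : ℝ) :
    Real.exp (4 * t) = Real.exp (6 * t) ^ (2 / 3 : ℝ) := by
  rw [← Real.exp_mul]
  congr 1
  ring

theorem sqrtDet_confMetric {M : Type*} (φ : M → ℝ) (g : M → Mat3) (x : M) :
    sqrtDet (confMetric φ g) x = Real.exp (6 * φ x) * sqrtDet g x := by
  have h_exp : Real.exp (4 * φ x) ^ 3 = Real.exp (6 * φ x) ^ 2 := by
    rw [← Real.exp_nat_mul, ← Real.exp_nat_mul]
    congr 1
    push_cast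
    ring
  rw [sqrtDet, confMetric, Matrix.det_smul, Fintype.card_fin, h_exp,
    Real.sqrt_mul (sq_nonneg _), Real.sqrt_sq (Real.exp_pos _).le, sqrtDet]

section Constraint

variable {M : Type*} [TopologicalSpace M] [ChartedSpace E3 M] [IsManifold (𝓡 3) ∞ M] [T2Space M]
  [CompactSpace M]

/-- The coefficient of `Ω⁻¹²` in `T_φ (S / √g)`. -/
def inverseSqCoeff (g π : M → Mat3) (x : M) : ℝ :=
  momSq g π x / (g x).det - (momTrace g π x / sqrtDet g x) ^ 2 / 2
    + meanMomTrace g π * (momTrace g π x / sqrtDet g x) / 3 - meanMomTrace g π ^ 2 / 6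

/-- The coefficient of `Ω⁻⁶` in `T_φ (S / √g)`. -/
def inverseCoeff (g π : M → Mat3) (x : M) : ℝ :=
  meanMomTrace g π * (meanMomTrace g π - momTrace g π x / sqrtDet g x) / 3

theorem transformedConstraint_eq (Λ : ℝ) (φ : M → ℝ) {g : M → Mat3} (π : M → Mat3) {x : M}
    (hsymm : (g x).IsSymm) (hdet : 0 < (g x).det) :
    transformedConstraint Λ φ g π x =
      inverseSqCoeff g π x / Real.exp (6 * φ x) ^ 2 + inverseCoeff g π x / Real.exp (6 * φ x)
        - meanMomTrace g π ^ 2 / 6 - scalarCurvature (confMetric φ g) x + 2 * Λ := by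
  have h_exp : Real.exp (4 * φ x) * Real.exp (-4 * φ x) = 1 := by
    rw [← Real.exp_add]
    simp
  have h_sqrt : sqrtDet g x ≠ 0 := (Real.sqrt_pos.2 hdet).ne'
  have h_sq : (g x).det = sqrtDet g x ^ 2 := (Real.sq_sqrt hdet.le).symm
  have h_tr : momTrace (confMetric φ g) (confMomentum φ g π) x =
      momTrace g π x - meanMomTrace g π * (1 - Real.exp (6 * φ x)) * sqrtDet g x := by
    refine (momTrace_smul_smul g _ x _ _).trans ?_
    rw [h_exp, momTrace_sub_smul_inv π hsymm hdet.ne']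
    ring
  have h_momSq : momSq (confMetric φ g) (confMomentum φ g π) x =
      momSq g π x - 2 / 3 * meanMomTrace g π * (1 - Real.exp (6 * φ x)) * sqrtDet g x *
        momTrace g π x + (meanMomTrace g π * (1 - Real.exp (6 * φ x)) * sqrtDet g x) ^ 2 / 3 := by
    refine (momSq_smul_smul g _ x _ _).trans ?_
    rw [h_exp, momSq_sub_smul_inv π hsymm hdet.ne']
    ring
  rw [transformedConstraint, scalarConstraint, h_tr, h_momSq, sqrtDet_confMetric,
    inverseSqCoeff, inverseCoeff, h_sq]
  have := Real.exp_pos (6 * φ x)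
  field_simp
  ring

/-- The squared mass `m²` of the linearized constraint, as a function of the background `(g, π)` and
of `w = Ω⁶`. -/
def massSq (g π : M → Mat3) (w : M → ℝ) (x : M) : ℝ :=
  scalarCurvature (fun z => w z ^ (2 / 3 : ℝ) • g z) x / 2
    - 3 / 4 * (2 * inverseSqCoeff g π x / w x ^ 2 + inverseCoeff g π x / w x)

end Constraint

section PointwiseVariation

variable {M : Type*} {n : ℕ} [NeZero n] {g₁ g₂ π₁ π₂ : ℝ → M → Mat3} {x : M}

theorem hasVariation_det_zero {A₁ A₂ : ℝ → Mat3}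
    (h : ∀ i j, HasVariation n (A₁ · i j) (A₂ · i j) 0) :
    HasVariation n (fun ε => (A₁ ε).det) (fun ε => (A₂ ε).det) 0 := by
  have h_mul (i j k : Fin 3) := ((h 0 i).mul (h 1 j)).mul (h 2 k)
  simp only [zero_mul, mul_zero, add_zero] at h_mul
  simp only [Matrix.det_fin_three]
  refine ((((((h_mul 0 1 2).sub (h_mul 0 2 1)).sub (h_mul 1 0 2)).add (h_mul 1 2 0)).add
    (h_mul 2 0 1)).sub (h_mul 2 1 0)).congr_variation (by simp only [sub_self, add_zero]) |>.congr
    (.of_forall fun ε => ?_) (.of_forall fun ε => ?_) <;> ring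

theorem hasVariation_momTrace_zero (hg : ∀ i j, HasVariation n (g₁ · x i j) (g₂ · x i j) 0)
    (hπ : ∀ i j, HasVariation n (π₁ · x i j) (π₂ · x i j) 0) :
    HasVariation n (fun ε => momTrace (g₁ ε) (π₁ ε) x) (fun ε => momTrace (g₂ ε) (π₂ ε) x) 0 :=
  (HasVariation.sum fun a _ => .sum fun b _ => (hπ a b).mul (hg a b)).congr_variation <| by
    simp only [zero_mul, mul_zero, add_zero, Finset.sum_const_zero]

theorem hasVariation_momSq_zero (hg : ∀ i j, HasVariation n (g₁ · x i j) (g₂ · x i j) 0)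
    (hπ : ∀ i j, HasVariation n (π₁ · x i j) (π₂ · x i j) 0) :
    HasVariation n (fun ε => momSq (g₁ ε) (π₁ ε) x) (fun ε => momSq (g₂ ε) (π₂ ε) x) 0 :=
  (HasVariation.sum fun a _ => .sum fun b _ => .sum fun c _ => .sum fun d _ =>
    (((hg a c).mul (hg b d)).mul (hπ a b)).mul (hπ c d)).congr_variation <| by
      simp only [zero_mul, mul_zero, add_zero, Finset.sum_const_zero]

theorem hasVariation_sqrtDet_zero (hg : ∀ i j, HasVariation n (g₁ · x i j) (g₂ · x i j) 0)
    (hdet : (g₁ 0 x).det ≠ 0) :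
    HasVariation n (fun ε => sqrtDet (g₁ ε) x) (fun ε => sqrtDet (g₂ ε) x) 0 :=
  (hasVariation_det_zero hg).comp_zero (Real.contDiffAt_sqrt hdet)

theorem hasVariation_exp_four_mul {f₁ f₂ : ℝ → ℝ} {d : ℝ}
    (hw : HasVariation n (fun ε => Real.exp (6 * f₁ ε)) (fun ε => Real.exp (6 * f₂ ε)) (d)) :
    HasVariation n (fun ε => Real.exp (4 * f₁ ε)) (fun ε => Real.exp (4 * f₂ ε))
      (2 / 3 * (d / Real.exp (6 * f₁ 0)) * Real.exp (4 * f₁ 0)) := by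
  have h_pos := Real.exp_pos (6 * f₁ 0)
  simp only [exp_four_mul_eq_rpow]
  refine (hw.comp_hasDerivAt (Real.contDiffAt_rpow_const_of_ne h_pos.ne')
    (Real.hasDerivAt_rpow_const (.inl h_pos.ne'))).congr_variation ?_
  rw [Real.rpow_sub_one h_pos.ne']
  ring

end PointwiseVariation

theorem confMetric_eq_rpow_smul {M : Type*} (φ : M → ℝ) (g : M → Mat3) :
    confMetric φ g = fun z => Real.exp (6 * φ z) ^ (2 / 3 : ℝ) • g z :=
  funext fun z => by rw [confMetric, exp_four_mul_eq_rpow]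

section Families

variable {M : Type*} [TopologicalSpace M] [ChartedSpace E3 M] [IsManifold (𝓡 3) ∞ M]

/-- A one-parameter family, smooth in the parameter `ε ∈ I` and the point together, of
phase-space points `(g_ε, π_ε)` and conformal factors `φ_ε`. Only the local consequences of
`g_ε` being a Riemannian metric and none of the symmetry of `π_ε` are recorded, so that Taylor
polynomials of a family are covered. -/
structure IsRegularFamily (I : Set ℝ) (g π : ℝ → M → Mat3) (φ : ℝ → M → ℝ) : Prop where
  isOpen : IsOpen I
  zero_mem : 0 ∈ I
  metric_isSymm : ∀ ε ∈ I, ∀ x, (g ε x).IsSymm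
  metric_det_pos : ∀ ε ∈ I, ∀ x, 0 < (g ε x).det
  metric_smooth : ∀ c i j,
    JointlySmoothOn I (extChartAt (𝓡 3) c).target fun ε y => covComp c (g ε) y i j
  momentum_smooth : ∀ c i j,
    JointlySmoothOn I (extChartAt (𝓡 3) c).target fun ε y => densComp c (π ε) y i j
  factor_smooth : ∀ c,
    JointlySmoothOn I (extChartAt (𝓡 3) c).target fun ε y => φ ε ((extChartAt (𝓡 3) c).symm y)

theorem covComp_confMetric_apply (c : M) (φ : M → ℝ) (g : M → Mat3) (y : E3) (i j : Fin 3) :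
    covComp c (confMetric φ g) y i j =
      Real.exp (4 * φ ((extChartAt (𝓡 3) c).symm y)) * covComp c g y i j :=
  congrFun (congrFun (covComp_smul c _ g y) i) j

theorem IsSmoothFamily.isRegularFamily {δ : ℝ} {g π : ℝ → M → Mat3} {φ : ℝ → M → ℝ}
    (h : IsSmoothFamily δ g π φ) (hδ : 0 < δ) : IsRegularFamily (Set.Ioo (-δ) δ) g π φ where
  isOpen := isOpen_Ioo
  zero_mem := ⟨neg_lt_zero.2 hδ, hδ⟩
  metric_isSymm ε hε := (h.metric ε hε).isSymm
  metric_det_pos ε hε := (h.metric ε hε).det_pos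
  metric_smooth := h.metric_smooth
  momentum_smooth := h.momentum_smooth
  factor_smooth := h.factor_smooth

namespace IsRegularFamily

variable {I J : Set ℝ} {g π : ℝ → M → Mat3} {φ : ℝ → M → ℝ}

theorem mono (h : IsRegularFamily I g π φ) (hJI : J ⊆ I) (hJ : IsOpen J) (h0 : 0 ∈ J) :
    IsRegularFamily J g π φ where
  isOpen := hJ
  zero_mem := h0
  metric_isSymm ε hε := h.metric_isSymm ε (hJI hε)
  metric_det_pos ε hε := h.metric_det_pos ε (hJI hε)
  metric_smooth c i j := (h.metric_smooth c i j).mono (Set.prod_mono_left hJI)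
  momentum_smooth c i j := (h.momentum_smooth c i j).mono (Set.prod_mono_left hJI)
  factor_smooth c := (h.factor_smooth c).mono (Set.prod_mono_left hJI)

theorem jointlySmoothOn_exp (h : IsRegularFamily I g π φ) (a : ℝ) (c : M) :
    JointlySmoothOn I (extChartAt (𝓡 3) c).target
      fun ε y => Real.exp (a * φ ε ((extChartAt (𝓡 3) c).symm y)) :=
  (contDiffOn_const.mul (h.factor_smooth c)).exp

theorem jointlySmoothOn_sqrtDet (h : IsRegularFamily I g π φ) (c : M) :
    JointlySmoothOn I (extChartAt (𝓡 3) c).target fun ε => scalarDensComp c (sqrtDet (g ε)) := by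
  simp only [JointlySmoothOn, scalarDensComp_sqrtDet]
  refine ContDiffOn.sqrt (fun p hp => ContDiffAt.contDiffWithinAt <|
    contDiffAt_matrix_det fun i j => ?_) fun p hp =>
      ((det_covComp_pos_iff (g p.1) hp.2).2 (h.metric_det_pos p.1 hp.1 _)).ne'
  exact (h.metric_smooth c i j).contDiffAt_uncurry h.isOpen (isOpen_extChartAt_target c) hp.1 hp.2

theorem jointlySmoothOn_momTrace (h : IsRegularFamily I g π φ) (c : M) :
    JointlySmoothOn I (extChartAt (𝓡 3) c).target
      fun ε => scalarDensComp c (momTrace (g ε) (π ε)) :=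
  (ContDiffOn.sum fun a _ => ContDiffOn.sum fun b _ =>
    (h.momentum_smooth c a b).mul (h.metric_smooth c a b)).congr
      fun p hp => scalarDensComp_momTrace (g p.1) (π p.1) hp.2

theorem isMetricFamilyOn_confMetric (h : IsRegularFamily I g π φ) (c : M) :
    IsMetricFamilyOn I (extChartAt (𝓡 3) c).target
      fun ε => covComp c (confMetric (φ ε) (g ε)) where
  symm ε hε y _ := covComp_isSymm c (fun x => (h.metric_isSymm ε hε x).smul _) y
  det_ne_zero ε hε y hy := by
    refine ((det_covComp_pos_iff _ hy).2 ?_).ne'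
    rw [confMetric, Matrix.det_smul]
    exact mul_pos (pow_pos (Real.exp_pos _) _) (h.metric_det_pos ε hε _)
  jointlySmoothOn i j := ((h.jointlySmoothOn_exp 4 c).mul (h.metric_smooth c i j)).congr
    fun p _ => covComp_confMetric_apply c _ _ p.2 i j

end IsRegularFamily

section Comparison

theorem hasVariation_covComp_zero {n : ℕ} {g₁ g₂ : ℝ → M → Mat3}
    (hg : ∀ x i j, HasVariation n (g₁ · x i j) (g₂ · x i j) 0)
    (c : M) (y : E3) (i j : Fin 3) :
    HasVariation n (fun ε => covComp c (g₁ ε) y i j) (fun ε => covComp c (g₂ ε) y i j) 0 := by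
  simp only [covComp, Matrix.mul_apply, Finset.sum_mul, mul_right_comm _ (g₁ _ _ _ _),
    mul_right_comm _ (g₂ _ _ _ _)]
  exact (HasVariation.sum fun b _ => .sum fun a _ => (hg _ a b).const_mul _).congr_variation
    (by simp only [mul_zero, Finset.sum_const_zero])

variable {n : ℕ} [NeZero n] {I : Set ℝ} {g₁ g₂ π₁ π₂ : ℝ → M → Mat3} {φ₁ φ₂ : ℝ → M → ℝ}
  {σ : M → ℝ}

theorem hasVariation_scalarCurvature_confMetric (h₁ : IsRegularFamily I g₁ π₁ φ₁)
    (h₂ : IsRegularFamily I g₂ π₂ φ₂)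
    (hg : ∀ x i j, HasVariation n (g₁ · x i j) (g₂ · x i j) 0)
    (hw : ∀ x, HasVariation n (fun ε => Real.exp (6 * φ₁ ε x)) (fun ε => Real.exp (6 * φ₂ ε x))
      (σ x)) (x : M) :
    HasVariation n (fun ε => scalarCurvature (confMetric (φ₁ ε) (g₁ ε)) x)
      (fun ε => scalarCurvature (confMetric (φ₂ ε) (g₂ ε)) x)
      (-(2 / 3 * (σ x / Real.exp (6 * φ₁ 0 x)) * scalarCurvature (confMetric (φ₁ 0) (g₁ 0)) x)
        - 4 / 3 * laplacian (confMetric (φ₁ 0) (g₁ 0)) (fun z => σ z / Real.exp (6 * φ₁ 0 z)) x)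
      := by
  have hU := isOpen_extChartAt_target (I := 𝓡 3) x
  have h_smooth : ContDiffOn ℝ ∞ (fun y => 2 / 3 * (σ ((extChartAt (𝓡 3) x).symm y) /
      Real.exp (6 * φ₁ 0 ((extChartAt (𝓡 3) x).symm y)))) (extChartAt (𝓡 3) x).target :=
    contDiffOn_const.mul <| (HasVariation.contDiffOn_variation (fun y _ => hw _) h₁.isOpen
      h₁.zero_mem hU (h₁.jointlySmoothOn_exp 6 x) (h₂.jointlySmoothOn_exp 6 x)).div
        ((h₁.jointlySmoothOn_exp 6 x).contDiffOn h₁.zero_mem) fun _ _ => (Real.exp_pos _).ne'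
  refine (hasVariation_coordScalarCurvature_conformal h₁.isOpen h₁.zero_mem hU
    (h₁.isMetricFamilyOn_confMetric x) (h₂.isMetricFamilyOn_confMetric x) h_smooth
    (fun y _ i j => ?_) (mem_extChartAt_target x)).congr_variation ?_
  · simp only [covComp_confMetric_apply]
    exact ((hasVariation_exp_four_mul (hw _)).mul
      (hasVariation_covComp_zero hg x y i j)).congr_variation (by ring)
  · rw [coordLaplacian_const_mul, extChartAt_to_inv]
    rw [scalarCurvature, laplacian]
    ring

theorem hasVariation_meanMomTrace_zero [T2Space M] [CompactSpace M] [Nonempty M]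
    (h₁ : IsRegularFamily I g₁ π₁ φ₁) (h₂ : IsRegularFamily I g₂ π₂ φ₂)
    (hg : ∀ x i j, HasVariation n (g₁ · x i j) (g₂ · x i j) 0)
    (hπ : ∀ x i j, HasVariation n (π₁ · x i j) (π₂ · x i j) 0) :
    HasVariation n (fun ε => meanMomTrace (g₁ ε) (π₁ ε)) (fun ε => meanMomTrace (g₂ ε) (π₂ ε))
      0 := by
  have h_vol : densIntegral (sqrtDet (g₁ 0)) ≠ 0 :=
    (densIntegral_pos (fun x => Real.sqrt_pos.2 (h₁.metric_det_pos 0 h₁.zero_mem x))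
      fun c => (h₁.jointlySmoothOn_sqrtDet c).contDiffOn h₁.zero_mem).ne'
  have h_trace := HasVariation.densIntegral (σ := 0)
    (fun x => hasVariation_momTrace_zero (hg x) (hπ x)) h₁.isOpen h₁.zero_mem
    h₁.jointlySmoothOn_momTrace h₂.jointlySmoothOn_momTrace
  have h_sqrt := HasVariation.densIntegral (σ := 0)
    (fun x => hasVariation_sqrtDet_zero (hg x) (h₁.metric_det_pos 0 h₁.zero_mem x).ne')
    h₁.isOpen h₁.zero_mem h₁.jointlySmoothOn_sqrtDet h₂.jointlySmoothOn_sqrtDet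
  rw [densIntegral_zero] at h_trace h_sqrt
  exact (h_trace.prodMk h_sqrt).comp_zero (contDiffAt_fst.div contDiffAt_snd h_vol)

section Constraint

variable [T2Space M] [CompactSpace M]

theorem hasVariation_inverseCoeffs_zero (h₁ : IsRegularFamily I g₁ π₁ φ₁)
    (h₂ : IsRegularFamily I g₂ π₂ φ₂) (hg : ∀ x i j, HasVariation n (g₁ · x i j) (g₂ · x i j) 0)
    (hπ : ∀ x i j, HasVariation n (π₁ · x i j) (π₂ · x i j) 0) (x : M) :
    HasVariation n (fun ε => inverseSqCoeff (g₁ ε) (π₁ ε) x)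
        (fun ε => inverseSqCoeff (g₂ ε) (π₂ ε) x) 0 ∧
      HasVariation n (fun ε => inverseCoeff (g₁ ε) (π₁ ε) x)
        (fun ε => inverseCoeff (g₂ ε) (π₂ ε) x) 0 := by
  have : Nonempty M := ⟨x⟩
  have h_det : 0 < (g₁ 0 x).det := h₁.metric_det_pos 0 h₁.zero_mem x
  have h_mean := hasVariation_meanMomTrace_zero h₁ h₂ hg hπ
  have h_sq := hasVariation_momSq_zero (hg x) (hπ x)
  have h_trace := (hasVariation_momTrace_zero (hg x) (hπ x)).prodMk
    (hasVariation_sqrtDet_zero (hg x) h_det.ne')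
  have h_sqrt : sqrtDet (g₁ 0) x ≠ 0 := (Real.sqrt_pos.2 h_det).ne'
  constructor
  · refine ((h_sq.prodMk (hasVariation_det_zero (hg x))).prodMk (h_trace.prodMk h_mean)).comp_zero
      (F := fun p : (ℝ × ℝ) × (ℝ × ℝ) × ℝ => p.1.1 / p.1.2 - (p.2.1.1 / p.2.1.2) ^ 2 / 2
        + p.2.2 * (p.2.1.1 / p.2.1.2) / 3 - p.2.2 ^ 2 / 6) ?_
    fun_prop (disch := first | exact h_det.ne' | exact h_sqrt)
  · refine (h_trace.prodMk h_mean).comp_zero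
      (F := fun p : (ℝ × ℝ) × ℝ => p.2 * (p.2 - p.1.1 / p.1.2) / 3) ?_
    fun_prop (disch := exact h_sqrt)

theorem hasVariation_transformedConstraint (Λ : ℝ) (h₁ : IsRegularFamily I g₁ π₁ φ₁)
    (h₂ : IsRegularFamily I g₂ π₂ φ₂) (hg : ∀ x i j, HasVariation n (g₁ · x i j) (g₂ · x i j) 0)
    (hπ : ∀ x i j, HasVariation n (π₁ · x i j) (π₂ · x i j) 0)
    (hw : ∀ x, HasVariation n (fun ε => Real.exp (6 * φ₁ ε x)) (fun ε => Real.exp (6 * φ₂ ε x))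
      (σ x)) (x : M) :
    HasVariation n (fun ε => transformedConstraint Λ (φ₁ ε) (g₁ ε) (π₁ ε) x)
      (fun ε => transformedConstraint Λ (φ₂ ε) (g₂ ε) (π₂ ε) x)
      (linearOperator (g₁ 0) (fun z => Real.exp (6 * φ₁ 0 z))
        (massSq (g₁ 0) (π₁ 0) fun z => Real.exp (6 * φ₁ 0 z)) σ x) := by
  have : Nonempty M := ⟨x⟩
  have h_mean := hasVariation_meanMomTrace_zero h₁ h₂ hg hπ
  obtain ⟨h_sq, h_inv⟩ := hasVariation_inverseCoeffs_zero h₁ h₂ hg hπ x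
  have h_pos := Real.exp_pos (6 * φ₁ 0 x)
  have h_mean_sq := h_mean.comp_zero (F := fun t => t ^ 2 / 6) (by fun_prop)
  have h_eq {g π : ℝ → M → Mat3} {φ : ℝ → M → ℝ} (h : IsRegularFamily I g π φ) :
      (fun ε => inverseSqCoeff (g ε) (π ε) x / (Real.exp (6 * φ ε x) * Real.exp (6 * φ ε x))
        + inverseCoeff (g ε) (π ε) x / Real.exp (6 * φ ε x) - meanMomTrace (g ε) (π ε) ^ 2 / 6
        - scalarCurvature (confMetric (φ ε) (g ε)) x + 2 * Λ) =ᶠ[𝓝 0]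
      fun ε => transformedConstraint Λ (φ ε) (g ε) (π ε) x := by
    filter_upwards [h.isOpen.mem_nhds h.zero_mem] with ε hε
    rw [transformedConstraint_eq Λ (φ ε) (π ε) (h.metric_isSymm ε hε x) (h.metric_det_pos ε hε x),
      sq (Real.exp _)]
  refine ((((((h_sq.div ((hw x).mul (hw x)) (mul_pos h_pos h_pos).ne').add
    (h_inv.div (hw x) h_pos.ne')).sub h_mean_sq).sub
    (hasVariation_scalarCurvature_confMetric h₁ h₂ hg hw x)).add
    (.refl (contDiffAt_const (c := 2 * Λ)))).congr (h_eq h₁) (h_eq h₂)).congr_variation ?_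
  rw [linearOperator, massSq, ← confMetric_eq_rpow_smul]
  field_simp
  ring

end Constraint

end Comparison

end Families

/-! ### Comparison with Taylor polynomials -/

section Taylor

variable {n : ℕ} {f : ℝ → ℝ}

theorem contDiff_sum_pow_mul {m : ℕ} (a : Fin m → ℝ) :
    ContDiff ℝ ∞ fun ε : ℝ => ∑ k : Fin m, ε ^ (k : ℕ) * a k :=
  ContDiff.sum fun _ _ => (contDiff_id.pow _).mul contDiff_const

theorem hasVariation_sum_epsCoeff_zero (n : ℕ) (hf : ContDiffAt ℝ ∞ f 0) :
    HasVariation n f (fun ε => ∑ k : Fin (n + 1), ε ^ (k : ℕ) * epsCoeff k f) 0 where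
  contDiffAt_left := hf
  contDiffAt_right := (contDiff_sum_pow_mul _).contDiffAt
  isLittleO := by
    simpa only [smul_zero, sub_zero, Finset.sum_range] using sub_sum_epsCoeff_isLittleO n hf

theorem hasVariation_sum_epsCoeff (n : ℕ) (hf : ContDiffAt ℝ ∞ f 0) :
    HasVariation n f (fun ε => ∑ k : Fin n, ε ^ (k : ℕ) * epsCoeff k f) (epsCoeff n f) where
  contDiffAt_left := hf
  contDiffAt_right := (contDiff_sum_pow_mul _).contDiffAt
  isLittleO := by
    simpa only [Finset.sum_range_succ, Finset.sum_range, smul_eq_mul, sub_add_eq_sub_sub] using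
      sub_sum_epsCoeff_isLittleO n hf

theorem sum_zero_pow_mul {m : ℕ} [NeZero m] (a : Fin m → ℝ) :
    ∑ k : Fin m, (0 : ℝ) ^ (k : ℕ) * a k = a 0 := by
  rw [Finset.sum_eq_single 0 (fun k _ hk => ?_) (by simp)]
  · simp
  · rw [zero_pow (Fin.val_ne_zero_iff.2 hk), zero_mul]

theorem JointlySmoothOn.sum_epsCoeff {E : Type*} [NormedAddCommGroup E] [NormedSpace ℝ E]
    {I : Set ℝ} {U : Set E} {A : ℝ → E → ℝ} (hA : JointlySmoothOn I U A) (hI : IsOpen I)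
    (h0 : 0 ∈ I) (hU : IsOpen U) (m : ℕ) :
    JointlySmoothOn Set.univ U
      fun ε y => ∑ k : Fin m, ε ^ (k : ℕ) * epsCoeff k (fun e => A e y) :=
  ContDiffOn.sum fun k _ => (contDiff_fst.pow _).contDiffOn.mul <|
    (hA.contDiffOn_epsCoeff hI h0 hU k).comp contDiffOn_snd fun _ hp => hp.2

end Taylor

section Polynomials

variable {M : Type*} {m : ℕ}

/-- The family of tensor fields that is polynomial in the parameter `ε` with coefficients `h`. -/
def tensorPolynomial (h : Fin m → M → Mat3) (ε : ℝ) (x : M) : Mat3 :=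
  ∑ k : Fin m, ε ^ (k : ℕ) • h k x

/-- The family of conformal factors `φ_ε` for which `Ω⁶ = e^{6φ}` is polynomial in the parameter `ε`
with coefficients `w`. It is meaningful only where that polynomial is positive. -/
def factorPolynomial (w : Fin m → M → ℝ) (ε : ℝ) (x : M) : ℝ :=
  Real.log (∑ i : Fin m, ε ^ (i : ℕ) * w i x) / 6

theorem tensorPolynomial_apply (h : Fin m → M → Mat3) (ε : ℝ) (x : M) (i j : Fin 3) :
    tensorPolynomial h ε x i j = ∑ k : Fin m, ε ^ (k : ℕ) * h k x i j := by
  simp only [tensorPolynomial, Matrix.sum_apply, Matrix.smul_apply, smul_eq_mul]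

theorem tensorPolynomial_pow_smul (s : ℝ) (h : Fin m → M → Mat3) (ε : ℝ) :
    tensorPolynomial (fun k => s ^ (k : ℕ) • h k) ε = tensorPolynomial h (s * ε) := by
  funext x
  simp only [tensorPolynomial, Pi.smul_apply, smul_smul, mul_pow, mul_comm]

theorem factorPolynomial_pow_smul (s : ℝ) (w : Fin m → M → ℝ) (ε : ℝ) :
    factorPolynomial (fun i => s ^ (i : ℕ) • w i) ε = factorPolynomial w (s * ε) := by
  funext x
  simp only [factorPolynomial, Pi.smul_apply, smul_eq_mul, mul_pow, mul_left_comm, mul_assoc]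

theorem exp_six_mul_factorPolynomial {w : Fin m → M → ℝ} {ε : ℝ} {x : M}
    (h_pos : 0 < ∑ i : Fin m, ε ^ (i : ℕ) * w i x) :
    Real.exp (6 * factorPolynomial w ε x) = ∑ i : Fin m, ε ^ (i : ℕ) * w i x := by
  rw [factorPolynomial, mul_div_cancel₀ _ (by norm_num), Real.exp_log h_pos]

theorem isSymm_tensorPolynomial {h : Fin m → M → Mat3} {x : M} (h_symm : ∀ k, (h k x).IsSymm)
    (ε : ℝ) : (tensorPolynomial h ε x).IsSymm := by
  simp only [Matrix.IsSymm, tensorPolynomial, Matrix.transpose_sum, Matrix.transpose_smul,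
    (h_symm _).eq]

theorem isSymm_tensorCoeff {g : ℝ → M → Mat3} {x : M} (hg : ∀ᶠ ε in 𝓝 0, (g ε x).IsSymm) (k : ℕ) :
    (tensorCoeff k g x).IsSymm :=
  Matrix.IsSymm.ext fun i j => epsCoeff_congr <| hg.mono fun _ hε => hε.apply i j

theorem tensorCoeff_zero (T : ℝ → M → Mat3) : tensorCoeff 0 T = T 0 := by
  ext x i j
  exact epsCoeff_zero _

theorem tensorPolynomial_tensorCoeff_zero (T : ℝ → M → Mat3) (n : ℕ) :
    tensorPolynomial (fun k : Fin (n + 1) => tensorCoeff k T) 0 = T 0 := by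
  ext x i j
  rw [tensorPolynomial_apply, sum_zero_pow_mul]
  exact congrFun (congrFun (congrFun (tensorCoeff_zero T) x) i) j

theorem mul_tensorCoeff_mul_apply {T : ℝ → M → Mat3} {x : M}
    (hT : ∀ i j, ContDiffAt ℝ ∞ (T · x i j) 0) (k : ℕ) (P Q : Mat3) (i j : Fin 3) :
    (P * tensorCoeff k T x * Q) i j = epsCoeff k fun ε => (P * T ε x * Q) i j := by
  simp only [Matrix.mul_apply, Finset.sum_mul, mul_right_comm _ (tensorCoeff _ _ _ _ _),
    mul_right_comm _ (T _ _ _ _)]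
  rw [epsCoeff_sum _ fun b _ => ContDiffAt.sum fun a _ => contDiffAt_const.mul (hT a b)]
  refine Finset.sum_congr rfl fun b _ => ?_
  rw [epsCoeff_sum _ fun a _ => contDiffAt_const.mul (hT a b)]
  exact Finset.sum_congr rfl fun a _ => (epsCoeff_const_mul k _ _).symm

end Polynomials

section Compactness

variable {M : Type*} [TopologicalSpace M] [ChartedSpace E3 M] [CompactSpace M]

theorem eventually_forall_of_forall_chart {ε₀ : ℝ} {P : ℝ → M → Prop}
    (h : ∀ c, ∀ᶠ p : ℝ × E3 in 𝓝 (ε₀, extChartAt (𝓡 3) c c),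
      P p.1 ((extChartAt (𝓡 3) c).symm p.2)) : ∀ᶠ ε in 𝓝 ε₀, ∀ x, P ε x := by
  suffices ∀ᶠ ε in 𝓝 ε₀, ∀ x ∈ Set.univ, P ε x by simpa only [Set.mem_univ, true_imp_iff]
  refine isCompact_univ.eventually_forall_of_forall_eventually fun c _ => ?_
  have h_cont : ContinuousAt (fun p : ℝ × M => (p.1, extChartAt (𝓡 3) c p.2)) (ε₀, c) :=
    continuousAt_fst.prodMk
      (ContinuousAt.comp' (continuousAt_extChartAt (I := 𝓡 3) c) continuousAt_snd)
  filter_upwards [h_cont.eventually (h c),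
    continuousAt_snd.eventually (extChartAt_source_mem_nhds (I := 𝓡 3) c)] with p hp h_source
  rwa [(extChartAt (𝓡 3) c).left_inv h_source] at hp

end Compactness

section Truncation

variable {M : Type*} [TopologicalSpace M] [ChartedSpace E3 M] [IsManifold (𝓡 3) ∞ M] {m : ℕ}

theorem covComp_tensorPolynomial_tensorCoeff {T : ℝ → M → Mat3}
    (hT : ∀ x i j, ContDiffAt ℝ ∞ (T · x i j) 0) (c : M) (ε : ℝ) (y : E3) (i j : Fin 3) :
    covComp c (tensorPolynomial (fun k : Fin m => tensorCoeff k T) ε) y i j =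
      ∑ k : Fin m, ε ^ (k : ℕ) * epsCoeff k fun e => covComp c (T e) y i j := by
  simp only [covComp, tensorPolynomial, ← mul_tensorCoeff_mul_apply (hT _), Matrix.mul_sum,
    Matrix.sum_mul, Matrix.mul_smul, Matrix.smul_mul, Matrix.sum_apply, Matrix.smul_apply,
    smul_eq_mul]

theorem densComp_tensorPolynomial_tensorCoeff {T : ℝ → M → Mat3}
    (hT : ∀ x i j, ContDiffAt ℝ ∞ (T · x i j) 0) (c : M) (ε : ℝ) (y : E3) (i j : Fin 3) :
    densComp c (tensorPolynomial (fun k : Fin m => tensorCoeff k T) ε) y i j =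
      ∑ k : Fin m, ε ^ (k : ℕ) * epsCoeff k fun e => densComp c (T e) y i j := by
  simp only [densComp, tensorPolynomial, Matrix.smul_apply, smul_eq_mul, epsCoeff_const_mul,
    ← mul_tensorCoeff_mul_apply (hT _), Finset.mul_sum, Matrix.sum_mul, Matrix.mul_smul,
    Matrix.smul_mul, Matrix.sum_apply, mul_left_comm]

namespace IsRegularFamily

variable {I : Set ℝ} {g π : ℝ → M → Mat3} {φ : ℝ → M → ℝ}

theorem contDiffAt_metric (h : IsRegularFamily I g π φ) (x : M) (i j : Fin 3) :
    ContDiffAt ℝ ∞ (g · x i j) 0 := by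
  simpa only [covComp_self] using
    (h.metric_smooth x i j).contDiffAt_param h.isOpen h.zero_mem (mem_extChartAt_target x)

theorem contDiffAt_momentum (h : IsRegularFamily I g π φ) (x : M) (i j : Fin 3) :
    ContDiffAt ℝ ∞ (π · x i j) 0 := by
  simpa only [densComp_self] using
    (h.momentum_smooth x i j).contDiffAt_param h.isOpen h.zero_mem (mem_extChartAt_target x)

theorem contDiffAt_exp_factor (h : IsRegularFamily I g π φ) (x : M) :
    ContDiffAt ℝ ∞ (fun ε => Real.exp (6 * φ ε x)) 0 := by
  simpa only [extChartAt_to_inv] using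
    (h.jointlySmoothOn_exp 6 x).contDiffAt_param h.isOpen h.zero_mem (mem_extChartAt_target x)

theorem jointlySmoothOn_covComp_tensorPolynomial (h : IsRegularFamily I g π φ) (m : ℕ) (c : M)
    (i j : Fin 3) :
    JointlySmoothOn Set.univ (extChartAt (𝓡 3) c).target fun ε y =>
      covComp c (tensorPolynomial (fun k : Fin m => tensorCoeff k g) ε) y i j := by
  simp only [covComp_tensorPolynomial_tensorCoeff h.contDiffAt_metric]
  exact (h.metric_smooth c i j).sum_epsCoeff h.isOpen h.zero_mem (isOpen_extChartAt_target c) m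

theorem jointlySmoothOn_densComp_tensorPolynomial (h : IsRegularFamily I g π φ) (m : ℕ) (c : M)
    (i j : Fin 3) :
    JointlySmoothOn Set.univ (extChartAt (𝓡 3) c).target fun ε y =>
      densComp c (tensorPolynomial (fun k : Fin m => tensorCoeff k π) ε) y i j := by
  simp only [densComp_tensorPolynomial_tensorCoeff h.contDiffAt_momentum]
  exact (h.momentum_smooth c i j).sum_epsCoeff h.isOpen h.zero_mem (isOpen_extChartAt_target c) m

theorem jointlySmoothOn_sum_omegaCoeff (h : IsRegularFamily I g π φ) (m : ℕ) (c : M) :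
    JointlySmoothOn Set.univ (extChartAt (𝓡 3) c).target fun ε y =>
      ∑ i : Fin m, ε ^ (i : ℕ) * omegaCoeff i φ ((extChartAt (𝓡 3) c).symm y) :=
  (h.jointlySmoothOn_exp 6 c).sum_epsCoeff h.isOpen h.zero_mem (isOpen_extChartAt_target c) m

variable [CompactSpace M] (n : ℕ)

theorem eventually_forall_sum_omegaCoeff_pos [NeZero n] (h : IsRegularFamily I g π φ) :
    ∀ᶠ ε in 𝓝 0, ∀ x, 0 < ∑ i : Fin n, ε ^ (i : ℕ) * omegaCoeff i φ x := by
  refine eventually_forall_of_forall_chart fun c => ?_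
  have h_cont := ((h.jointlySmoothOn_sum_omegaCoeff n c).contDiffAt_uncurry isOpen_univ
    (isOpen_extChartAt_target c) (Set.mem_univ 0) (mem_extChartAt_target c)).continuousAt
  refine h_cont.eventually_const_lt ?_
  simp only [sum_zero_pow_mul, omegaCoeff, Fin.coe_ofNat_eq_mod, Nat.zero_mod, epsCoeff_zero]
  exact Real.exp_pos _

theorem eventually_forall_det_tensorPolynomial_pos (h : IsRegularFamily I g π φ) :
    ∀ᶠ ε in 𝓝 0, ∀ x,
      0 < (tensorPolynomial (fun k : Fin (n + 1) => tensorCoeff k g) ε x).det := by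
  refine eventually_forall_of_forall_chart fun c => ?_
  have h_cont := (contDiffAt_matrix_det fun i j =>
    (h.jointlySmoothOn_covComp_tensorPolynomial (n + 1) c i j).contDiffAt_uncurry isOpen_univ
      (isOpen_extChartAt_target c) (Set.mem_univ 0) (mem_extChartAt_target c)).continuousAt
  have h_pos : 0 < (covComp c (tensorPolynomial (fun k : Fin (n + 1) => tensorCoeff k g) 0)
      (extChartAt (𝓡 3) c c)).det := by
    rw [tensorPolynomial_tensorCoeff_zero, covComp_self]
    exact h.metric_det_pos 0 h.zero_mem c
  filter_upwards [h_cont.eventually_const_lt h_pos,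
    continuousAt_snd.eventually (extChartAt_target_mem_nhds (I := 𝓡 3) c)] with p hp hy
  using (det_covComp_pos_iff _ hy).1 hp

theorem exists_truncation [NeZero n] (h : IsRegularFamily I g π φ) :
    ∃ J ⊆ I, IsRegularFamily J (tensorPolynomial fun k : Fin (n + 1) => tensorCoeff k g)
      (tensorPolynomial fun k : Fin (n + 1) => tensorCoeff k π)
      (factorPolynomial fun i : Fin n => omegaCoeff i φ) := by
  obtain ⟨J, hJ, hJ_open, h0⟩ := eventually_nhds_iff.1 <|
    (h.isOpen.eventually_mem h.zero_mem).and <|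
      (h.eventually_forall_det_tensorPolynomial_pos n).and
        (h.eventually_forall_sum_omegaCoeff_pos n)
  have h_sub (c : M) : J ×ˢ (extChartAt (𝓡 3) c).target ⊆
      Set.univ ×ˢ (extChartAt (𝓡 3) c).target := Set.prod_mono_left (Set.subset_univ J)
  refine ⟨J, fun ε hε => (hJ ε hε).1, hJ_open, h0, fun ε _ x => ?_, fun ε hε => (hJ ε hε).2.1,
    fun c i j => ?_, fun c i j => ?_, fun c => ?_⟩
  · refine isSymm_tensorPolynomial (fun k => isSymm_tensorCoeff ?_ k) ε
    filter_upwards [h.isOpen.mem_nhds h.zero_mem] with e he using h.metric_isSymm e he x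
  · exact (h.jointlySmoothOn_covComp_tensorPolynomial (n + 1) c i j).mono (h_sub c)
  · exact (h.jointlySmoothOn_densComp_tensorPolynomial (n + 1) c i j).mono (h_sub c)
  · exact (((h.jointlySmoothOn_sum_omegaCoeff n c).mono (h_sub c)).log
      fun p hp => ((hJ p.1 hp.1).2.2 _).ne').div_const 6

variable [T2Space M]

theorem hasVariation_transformedConstraint_truncation [NeZero n] (h : IsRegularFamily I g π φ)
    (Λ : ℝ) (x : M) :
    HasVariation n (fun ε => transformedConstraint Λ (φ ε) (g ε) (π ε) x)
      (fun ε => transformedConstraint Λ (factorPolynomial (fun i : Fin n => omegaCoeff i φ) ε)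
        (tensorPolynomial (fun k : Fin (n + 1) => tensorCoeff k g) ε)
        (tensorPolynomial (fun k : Fin (n + 1) => tensorCoeff k π) ε) x)
      (linearOperator (g 0) (omegaCoeff 0 φ) (massSq (g 0) (π 0) (omegaCoeff 0 φ))
        (omegaCoeff n φ) x) := by
  obtain ⟨J, hJI, hJ⟩ := h.exists_truncation n
  have h_omega : omegaCoeff 0 φ = fun z => Real.exp (6 * φ 0 z) := funext fun z => epsCoeff_zero _
  have h_entry {T : ℝ → M → Mat3} (hT : ∀ x i j, ContDiffAt ℝ ∞ (T · x i j) 0) (x : M)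
      (i j : Fin 3) : HasVariation n (T · x i j)
        (tensorPolynomial (fun k : Fin (n + 1) => tensorCoeff k T) · x i j) 0 := by
    simp only [tensorPolynomial_apply]
    exact hasVariation_sum_epsCoeff_zero n (hT x i j)
  rw [h_omega]
  refine hasVariation_transformedConstraint Λ (h.mono hJI hJ.isOpen hJ.zero_mem) hJ
    (h_entry h.contDiffAt_metric) (h_entry h.contDiffAt_momentum) (fun z => ?_) x
  refine (hasVariation_sum_epsCoeff n (h.contDiffAt_exp_factor z)).congr .rfl ?_
  filter_upwards [h.eventually_forall_sum_omegaCoeff_pos n] with ε hε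
  exact (exp_six_mul_factorPolynomial (hε z)).symm

theorem epsCoeff_transformedConstraint_eq_zero_cosmologicalConstant {k : ℕ}
    (h : IsRegularFamily I g π φ) (hk : 0 < k) (Λ : ℝ) (x : M) :
    epsCoeff k (fun ε => transformedConstraint Λ (φ ε) (g ε) (π ε) x) =
      epsCoeff k fun ε => transformedConstraint 0 (φ ε) (g ε) (π ε) x := by
  rw [← epsCoeff_add_const hk (fun ε => transformedConstraint 0 _ _ _ x) (2 * Λ)]
  refine epsCoeff_congr ?_
  filter_upwards [h.isOpen.mem_nhds h.zero_mem] with ε hε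
  simp only [transformedConstraint_eq _ (φ ε) (π ε) (h.metric_isSymm ε hε x)
    (h.metric_det_pos ε hε x), mul_zero, add_zero]

end IsRegularFamily

variable [T2Space M] [CompactSpace M]

/-- `f₍ₙ₎`: the negative of the coefficient of `εⁿ` in `T_φ (S / √g)` along the polynomial family
with coefficients `w`, `h` and `p`. The cosmological constant is set to zero since it does not
contribute to the coefficients of positive order. -/
def sourceTerm (n : ℕ) (w : Fin n → M → ℝ) (h p : Fin (n + 1) → M → Mat3) (x : M) : ℝ :=
  -epsCoeff n fun ε =>
    transformedConstraint 0 (factorPolynomial w ε) (tensorPolynomial h ε) (tensorPolynomial p ε) x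

theorem sourceTerm_pow_smul (n : ℕ) (s : ℝ) (w : Fin n → M → ℝ) (h p : Fin (n + 1) → M → Mat3)
    (x : M) :
    sourceTerm n (fun i => s ^ (i : ℕ) • w i) (fun k => s ^ (k : ℕ) • h k)
      (fun k => s ^ (k : ℕ) • p k) x = s ^ n * sourceTerm n w h p x := by
  simp only [sourceTerm, tensorPolynomial_pow_smul, factorPolynomial_pow_smul, mul_neg]
  rw [← epsCoeff_comp_mul_left]

theorem IsRegularFamily.epsCoeff_transformedConstraint {I : Set ℝ} {g π : ℝ → M → Mat3}
    {φ : ℝ → M → ℝ} (h : IsRegularFamily I g π φ) {n : ℕ} [NeZero n] (Λ : ℝ) (x : M) :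
    epsCoeff n (fun ε => transformedConstraint Λ (φ ε) (g ε) (π ε) x) =
      linearOperator (g 0) (omegaCoeff 0 φ) (massSq (g 0) (π 0) (omegaCoeff 0 φ))
          (omegaCoeff n φ) x
        - sourceTerm n (fun i => omegaCoeff i φ) (fun k => tensorCoeff k g)
            (fun k => tensorCoeff k π) x := by
  obtain ⟨J, -, hJ⟩ := h.exists_truncation n
  obtain ⟨-, -, -, h_diff⟩ :=
    hasVariation_iff.1 (h.hasVariation_transformedConstraint_truncation n Λ x)
  rw [sourceTerm, ← h_diff, ← hJ.epsCoeff_transformedConstraint_eq_zero_cosmologicalConstant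
    (NeZero.pos n) Λ x]
  ring

end Truncation

end

end ShapeDynamics

theorem mainTheorem2 {M : Type*} [TopologicalSpace M] [ChartedSpace ShapeDynamics.E3 M]
    [IsManifold (𝓡 3) ∞ M] [T2Space M] [CompactSpace M] (n : ℕ) (hn : 0 < n) :
    ∃ (msq : (M → ShapeDynamics.Mat3) → (M → ShapeDynamics.Mat3) → (M → ℝ) → M → ℝ)
      (f : (Fin n → M → ℝ) → (Fin (n + 1) → M → ShapeDynamics.Mat3) →
        (Fin (n + 1) → M → ShapeDynamics.Mat3) → M → ℝ),
      (∀ (s : ℝ) (w : Fin n → M → ℝ) (h p : Fin (n + 1) → M → ShapeDynamics.Mat3) (x : M),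
        f (fun i => s ^ (i : ℕ) • w i) (fun k => s ^ (k : ℕ) • h k)
          (fun k => s ^ (k : ℕ) • p k) x = s ^ n * f w h p x) ∧
      ∀ (Λ δ : ℝ) (g π : ℝ → M → ShapeDynamics.Mat3) (φ : ℝ → M → ℝ), 0 < δ →
        ShapeDynamics.IsSmoothFamily δ g π φ →
        (∀ x, ContDiffAt ℝ ∞
          (fun ε => ShapeDynamics.transformedConstraint Λ (φ ε) (g ε) (π ε) x) 0) ∧
        (∀ x, ShapeDynamics.epsCoeff n
            (fun ε => ShapeDynamics.transformedConstraint Λ (φ ε) (g ε) (π ε) x) =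
          ShapeDynamics.linearOperator (g 0) (ShapeDynamics.omegaCoeff 0 φ)
              (msq (g 0) (π 0) (ShapeDynamics.omegaCoeff 0 φ))
              (ShapeDynamics.omegaCoeff n φ) x
            - f (fun i => ShapeDynamics.omegaCoeff i φ)
                (fun k => ShapeDynamics.tensorCoeff k g)
                (fun k => ShapeDynamics.tensorCoeff k π) x) ∧
        (∀ Hdual : ℝ → ℝ,
          (∀ᶠ ε in 𝓝 0, ∀ x,
            ShapeDynamics.transformedConstraint Λ (φ ε) (g ε) (π ε) x = Hdual ε) →
          ∀ x, ShapeDynamics.epsCoeff n Hdual =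
            ShapeDynamics.linearOperator (g 0) (ShapeDynamics.omegaCoeff 0 φ)
                (msq (g 0) (π 0) (ShapeDynamics.omegaCoeff 0 φ))
                (ShapeDynamics.omegaCoeff n φ) x
              - f (fun i => ShapeDynamics.omegaCoeff i φ)
                  (fun k => ShapeDynamics.tensorCoeff k g)
                  (fun k => ShapeDynamics.tensorCoeff k π) x) := by
  have : NeZero n := ⟨hn.ne'⟩
  refine ⟨ShapeDynamics.massSq, ShapeDynamics.sourceTerm n, ShapeDynamics.sourceTerm_pow_smul n,
    fun Λ δ g π φ hδ h => ?_⟩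
  have h_reg := h.isRegularFamily hδ
  have h_coeff := h_reg.epsCoeff_transformedConstraint (n := n) Λ
  refine ⟨fun x => (h_reg.hasVariation_transformedConstraint_truncation n Λ x).contDiffAt_left,
    h_coeff, fun Hdual h_dual x => ?_⟩
  rw [← h_coeff]
  exact ShapeDynamics.epsCoeff_congr (h_dual.mono fun ε hε => (hε x).symm)
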